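/- Let $g\ge 2$, let $\mathcal A=\{a_1^{\pm1},b_1^{\pm1},\dots,a_g^{\pm1},b_g^{\pm1}\}$, let $r=[a_1\,b_1]\cdots[a_g\,b_g]$ with $[x\,y]=xyx^{-1}y^{-1}$, and let $\Gamma_g=\langle a_1,b_1,\dots,a_g,b_g\mid r\rangle$. Let $\omega$ be a word in $\mathcal A$ that is a cyclically shortest representative of an element of $\Gamma_g$, i.e. $\omega$ has minimal length among all words representing an element conjugate to $\omega$ in $\Gamma_g$. Let $n,m\ge 0$ be integers. **Diagrams.** For a finite set $I$ and $\varepsilon:I\to\{\pm1\}$, let $\mathcal D_\varepsilon$ be the set of fixed-point-free involutions $\pi$ of $I\times\{\pm1\}$ with $\varepsilon(v')\eta'=-\varepsilon(v)\eta$ whenever $\pi(v,\eta)=(v',\eta')$; the vertices $(v,1)$ are top and the $(v,-1)$ bottom. Let $h(\pi)$ be the number of pairs of top vertices matched by $\pi$. For a word $w=x_1\cdots x_s$ in $\mathcal A$ whose letters have exponents $\varepsilon_1,\dots,\varepsilon_s\in\{\pm1\}$, let $\pi_w\in\mathcal D_\varepsilon$ be the diagram on $\{1,\dots,s\}$ with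 $\pi_w(i,-\varepsilon_i)=(i+1,\varepsilon_{i+1})$, indices modulo $s$. Let $\pi_r^{n,m}$ be obtained from $\pi_r$ by replacing each string by $n+m$ parallel copies, and let $\pi^{n,m}_{r,\omega}$ be the juxtaposition $\pi_r^{n,m}\otimes\pi_\omega\otimes\pi_{\omega^{-1}}$, on a set $I$ of $|r|(n+m)+2|\omega|$ positions. It carries an arc colouring $\mathfrak a:I\to\mathcal A$ and a boundary colouring $\mathfrak b:I\to\{R,R^{-1},W,W^{-1}\}$: the $n$ first copies of the $i$-th position of $r$ are coloured by the $i$-th letter of $r$ and by $R$, the $m$ last copies by the inverse of that letter and by $R^{-1}$, and the positions of $\omega$ (resp. $\omega^{-1}$) by their letters and by $W$ (resp. $W^{-1}$). Let $\varepsilon(v)$ be the exponent of $\mathfrak a(v)$; then $\pi^{n,m}_{r,\omega}\in\mathcal D_\varepsilon$. A diagram in $\mathcal D_\varepsilon$ is compatible if $\mathfrak a$ and $\mathfrak b$ take equal values at $v,v'$ whenever it matches $(v,-1)$ with $(v',1)$, and inverse values whenever it matches $(v,\eta)$ with $(v',\eta)$. For bijections $\alpha,\beta:\varepsilon^{-1}(-1)\to\varepsilon^{-1}(1)$,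 let $\pi_{\alpha,\beta}\in\mathcal D_\varepsilon$ match $(v,1)$ with $(\alpha(v),1)$ and $(v,-1)$ with $(\beta(v),-1)$. Let $S_{\mathfrak a,\mathfrak b}$ be the set of such bijections $\alpha$ with $\mathfrak a(\alpha(v))=\mathfrak a(v)^{-1}$ for all $v$ and $\{\mathfrak b(v),\mathfrak b(\alpha(v))\}\ne\{R,R^{-1}\}$ for all $v$. **Brauer maps.** An admissible Brauer map $\mathfrak m=(\tau_u,\pi^{n,m}_{r,\omega},\tau_b,\varphi)$ consists of compatible diagrams $\tau_u,\tau_b$ that are the identity diagram (matching $(v,1)$ with $(v,-1)$) at all positions coloured $W$ or $W^{-1}$, and of $\varphi=\pi_{\alpha,\beta}$ with $\alpha,\beta\in S_{\mathfrak a,\mathfrak b}$. Set $h(\mathfrak m)=h(\tau_u)+h(\tau_b)$. The surface $\Sigma_{\mathfrak m}$ is the total space of the following 2-dimensional CW complex. Its 0-cells are the points of $I\times\{-2,-1,0,1,2\}$ with $(i,2)$ and $(i,-2)$ identified. Its 1-cells are one interval for each matched pair of $\tau_u,\pi^{n,m}_{r,\omega},\tau_b,\varphi$, these diagrams being drawn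 between the levels $1,2$; $0,1$; $-1,0$; $-2,-1$ respectively, and one vertical interval from $(i,-2)$ to $(i,-1)$ for each $i\in I$. Its 2-cells are one disc glued along each circle formed by the intervals of $\tau_u,\pi^{n,m}_{r,\omega},\tau_b,\varphi$, and one disc glued along each circle formed by the intervals of $\varphi$ and the vertical intervals. **Proposition.** Every admissible Brauer map $\mathfrak m=(\tau_u,\pi^{n,m}_{r,\omega},\tau_b,\varphi)$ satisfies $$\chi(\Sigma_{\mathfrak m})\le -n-m+h(\mathfrak m).$$ -/

import Mathlib

namespace WalledBrauer

/-! ### Letters and words -/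

/-- A letter of the alphabet `{x, x⁻¹ : x ∈ X}`: `(x, true)` is `x` and `(x, false)` is `x⁻¹`.
Words are lists of letters, as for `FreeGroup`. -/
abbrev Letter (X : Type) : Type := X × Bool

/-- The inverse letter. -/
def Letter.inv {X : Type} (l : Letter X) : Letter X := (l.1, !l.2)

/-- The exponent `1` or `-1` of a letter. -/
def Letter.sign {X : Type} (l : Letter X) : ℤˣ := if l.2 then 1 else -1

theorem Letter.sign_inv {X : Type} (l : Letter X) : l.inv.sign = -l.sign := by
  rcases l with ⟨x, b⟩
  cases b <;> simp [Letter.inv, Letter.sign]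

/-! ### Walled Brauer diagrams -/

/-- Self-maps of `ι × {-1, 1}`; `ι` is the set of strand positions, `(v, 1)` is the top vertex and
`(v, -1)` the bottom vertex at position `v`. -/
abbrev Diagram (ι : Type) : Type := ι × ℤˣ → ι × ℤˣ

/-- The set `𝒟_ε` of `ε`-walled Brauer diagrams: fixed point free involutions `π` with
`ε(v') η' = - ε(v) η` whenever `π (v, η) = (v', η')`. -/
def walledDiagrams {ι : Type} (ε : ι → ℤˣ) : Set (Diagram ι) :=
  {π | Function.Involutive π ∧ (∀ p, π p ≠ p) ∧ ∀ p, ε (π p).1 * (π p).2 = -(ε p.1 * p.2)}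

/-- The strings of a diagram: its pairs of matched vertices. -/
def strings {ι : Type} (π : Diagram ι) : Set (Sym2 (ι × ℤˣ)) := Set.range fun p => s(p, π p)

/-- The number of top horizontal strings (equal to the number of bottom ones for walled diagrams
on finitely many positions). -/
noncomputable def horizontalCount {ι : Type} (π : Diagram ι) : ℕ :=
  {e ∈ strings π | ∀ p ∈ e, p.2 = 1}.ncard

/-- The diagram of a permutation, joining `(v, -1)` to `(σ v, 1)`. -/
def permDiagram {ι : Type} (σ : Equiv.Perm ι) : Diagram ι :=
  fun p => if p.2 = -1 then (σ p.1, 1) else (σ.symm p.1, -1)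

/-- The transposition `ε' π ε'`, where `ε'` acts by `(v, η) ↦ (v, ε'(v) η)`. -/
def transposeDiagram {ι : Type} (ε' : ι → ℤˣ) (π : Diagram ι) : Diagram ι :=
  fun p =>
    let q := π (p.1, ε' p.1 * p.2)
    (q.1, ε' q.1 * q.2)

/-- Juxtaposition of diagrams. -/
def juxtapose {ι κ : Type} (π : Diagram ι) (ρ : Diagram κ) : Diagram (ι ⊕ κ)
  | (Sum.inl v, η) => (Sum.inl (π (v, η)).1, (π (v, η)).2)
  | (Sum.inr v, η) => (Sum.inr (ρ (v, η)).1, (ρ (v, η)).2)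

/-- The extension `π^{n,m}`: every string is replaced by `n + m` parallel copies. -/
def extendDiagram {ι : Type} (n m : ℕ) (π : Diagram ι) : Diagram (ι × (Fin n ⊕ Fin m)) :=
  fun p => (((π (p.1.1, p.2)).1, p.1.2), (π (p.1.1, p.2)).2)

/-- The diagram `π_w = (1 2 … s)^ε` of a word `w` of length `s` with sign function `ε`. -/
def wordDiagram {X : Type} (w : List (Letter X)) : Diagram (Fin w.length) :=
  transposeDiagram (fun i => (w.get i).sign) (permDiagram (finRotate w.length))

/-! ### Colourings -/

/-- The labels `R, R⁻¹, W, W⁻¹` of the boundary colouring. -/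
inductive BdryLabel : Type
  | R | Rinv | W | Winv

/-- Formal inversion of labels. -/
def BdryLabel.inv : BdryLabel → BdryLabel
  | R => Rinv
  | Rinv => R
  | W => Winv
  | Winv => W

/-- The sign function of an arc colouring. -/
def arcSign {ι X : Type} (a : ι → Letter X) : ι → ℤˣ := fun v => (a v).sign

/-- The set `𝒟_{𝔞,𝔟}` of compatible diagrams: strings from bottom to top preserve both colours,
horizontal strings invert both colours. -/
def compatibleDiagrams {ι X : Type} (a : ι → Letter X) (b : ι → BdryLabel) : Set (Diagram ι) :=
  {μ | μ ∈ walledDiagrams (arcSign a) ∧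
    (∀ v v', μ (v, -1) = (v', 1) → a v' = a v ∧ b v' = b v) ∧
    ∀ v v' η, μ (v, η) = (v', η) → a v' = (a v).inv ∧ b v' = (b v).inv}

/-- Extension of an arc colouring: the last `m` copies get the inverse letter. -/
def extendArc {ι X : Type} (n m : ℕ) (a : ι → Letter X) : ι × (Fin n ⊕ Fin m) → Letter X
  | (v, Sum.inl _) => a v
  | (v, Sum.inr _) => (a v).inv

/-- Extension of a boundary colouring: the last `m` copies get the inverse label. -/
def extendBdry {ι : Type} (n m : ℕ) (b : ι → BdryLabel) : ι × (Fin n ⊕ Fin m) → BdryLabel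
  | (v, Sum.inl _) => b v
  | (v, Sum.inr _) => (b v).inv

/-! ### The second moment diagram `π_r^{n,m} ⊗ π_w ⊗ π_{w⁻¹}` -/

/-- The `|r| (n + m) + 2 |w|` strand positions. -/
abbrev SecondMomentIndex {X : Type} (n m : ℕ) (r w : List (Letter X)) : Type :=
  (Fin r.length × (Fin n ⊕ Fin m)) ⊕ (Fin w.length ⊕ Fin (FreeGroup.invRev w).length)

/-- The diagram `π^{n,m}_{r,w} = π_r^{n,m} ⊗ π_w ⊗ π_{w⁻¹}`. -/
def secondMomentDiagram {X : Type} (n m : ℕ) (r w : List (Letter X)) :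
    Diagram (SecondMomentIndex n m r w) :=
  juxtapose (extendDiagram n m (wordDiagram r))
    (juxtapose (wordDiagram w) (wordDiagram (FreeGroup.invRev w)))

/-- The arc colouring of `π^{n,m}_{r,w}`. -/
def secondMomentArc {X : Type} (n m : ℕ) (r w : List (Letter X)) :
    SecondMomentIndex n m r w → Letter X :=
  Sum.elim (extendArc n m r.get) (Sum.elim w.get (FreeGroup.invRev w).get)

/-- The boundary colouring of `π^{n,m}_{r,w}`. -/
def secondMomentBdry {X : Type} (n m : ℕ) (r w : List (Letter X)) :
    SecondMomentIndex n m r w → BdryLabel :=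
  Sum.elim (extendBdry n m fun _ => BdryLabel.R)
    (Sum.elim (fun _ => BdryLabel.W) fun _ => BdryLabel.Winv)

theorem permDiagram_mem {ι : Type} (σ : Equiv.Perm ι) :
    permDiagram σ ∈ walledDiagrams (fun _ : ι => (1 : ℤˣ)) := by
  refine ⟨?_, ?_, ?_⟩ <;> rintro ⟨v, η⟩ <;> rcases Int.units_eq_one_or η with rfl | rfl <;>
    simp [permDiagram, Prod.ext_iff]

theorem transposeDiagram_mem {ι : Type} {ε : ι → ℤˣ} (ε' : ι → ℤˣ) {π : Diagram ι}
    (h : π ∈ walledDiagrams ε) : transposeDiagram ε' π ∈ walledDiagrams (fun v => ε v * ε' v) := by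
  obtain ⟨h1, h2, h3⟩ := h
  have hs : ∀ u x : ℤˣ, u * (u * x) = x := fun u x => by
    rw [← mul_assoc, Int.units_mul_self, one_mul]
  refine ⟨?_, ?_, ?_⟩
  · rintro ⟨v, η⟩
    have := h1 (v, ε' v * η)
    simp only [transposeDiagram, hs, Prod.mk.eta, this]
  · rintro ⟨v, η⟩ h
    apply h2 (v, ε' v * η)
    simp only [transposeDiagram, Prod.mk.injEq] at h
    obtain ⟨ha, hb⟩ := h
    rw [ha] at hb
    refine Prod.ext ha ?_
    show (π (v, ε' v * η)).2 = ε' v * η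
    rw [← hs (ε' v) (π (v, ε' v * η)).2, hb]
  · rintro ⟨v, η⟩
    have := h3 (v, ε' v * η)
    simp only [transposeDiagram] at this ⊢
    rw [mul_assoc, hs, this, mul_assoc]

theorem wordDiagram_mem {X : Type} (w : List (Letter X)) :
    wordDiagram w ∈ walledDiagrams (arcSign w.get) := by
  have := transposeDiagram_mem (fun i => (w.get i).sign) (permDiagram_mem (finRotate w.length))
  simp only [one_mul] at this
  exact this

theorem extendDiagram_mem {ι X : Type} (n m : ℕ) {a : ι → Letter X} {π : Diagram ι}
    (h : π ∈ walledDiagrams (arcSign a)) :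
    extendDiagram n m π ∈ walledDiagrams (arcSign (extendArc n m a)) := by
  obtain ⟨h1, h2, h3⟩ := h
  refine ⟨?_, ?_, ?_⟩
  · rintro ⟨⟨v, k⟩, η⟩
    simp only [extendDiagram, Prod.mk.eta, h1 (v, η)]
  · rintro ⟨⟨v, k⟩, η⟩ h
    simp only [extendDiagram, Prod.mk.injEq] at h
    exact h2 (v, η) (Prod.ext h.1.1 h.2)
  · rintro ⟨⟨v, k | k⟩, η⟩
    · exact h3 (v, η)
    · have := h3 (v, η)
      simp only [arcSign] at this
      simp only [arcSign, extendDiagram, extendArc, Letter.sign_inv, neg_mul, this]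

theorem juxtapose_mem {ι κ X : Type} {a : ι → Letter X} {c : κ → Letter X}
    {π : Diagram ι} {ρ : Diagram κ}
    (h : π ∈ walledDiagrams (arcSign a)) (h' : ρ ∈ walledDiagrams (arcSign c)) :
    juxtapose π ρ ∈ walledDiagrams (arcSign (Sum.elim a c)) := by
  obtain ⟨h1, h2, h3⟩ := h
  obtain ⟨k1, k2, k3⟩ := h'
  refine ⟨?_, ?_, ?_⟩
  · rintro ⟨v | v, η⟩
    · simp only [juxtapose, Prod.mk.eta, h1 (v, η)]
    · simp only [juxtapose, Prod.mk.eta, k1 (v, η)]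
  · rintro ⟨v | v, η⟩ h
    · simp only [juxtapose, Prod.mk.injEq, Sum.inl.injEq] at h
      exact h2 (v, η) (Prod.ext h.1 h.2)
    · simp only [juxtapose, Prod.mk.injEq, Sum.inr.injEq] at h
      exact k2 (v, η) (Prod.ext h.1 h.2)
  · rintro ⟨v | v, η⟩
    · exact h3 (v, η)
    · exact k3 (v, η)

/-- `π^{n,m}_{r,w}` is a walled Brauer diagram for the sign function of its arc colouring. -/
theorem secondMomentDiagram_mem {X : Type} (n m : ℕ) (r w : List (Letter X)) :
    secondMomentDiagram n m r w ∈ walledDiagrams (arcSign (secondMomentArc n m r w)) :=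
  juxtapose_mem (extendDiagram_mem n m (wordDiagram_mem r))
    (juxtapose_mem (wordDiagram_mem w) (wordDiagram_mem (FreeGroup.invRev w)))

/-! ### Horizontal diagrams -/

/-- The set `S_ε` of bijections from `ε⁻¹(-1)` to `ε⁻¹(1)`. -/
abbrev SignMatching {ι : Type} (ε : ι → ℤˣ) : Type := {v // ε v = -1} ≃ {v // ε v = 1}

/-- The fixed point free involution of `ι` defined by an element of `S_ε`. -/
def SignMatching.partner {ι : Type} {ε : ι → ℤˣ} (α : SignMatching ε) (v : ι) : ι :=
  if h : ε v = -1 then (α ⟨v, h⟩ : ι)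
  else (α.symm ⟨v, (Int.units_eq_one_or (ε v)).resolve_right h⟩ : ι)

/-- The horizontal diagram `π_{α,β}`, matching top vertices by `α` and bottom vertices by `β`. -/
def horizontalDiagram {ι : Type} {ε : ι → ℤˣ} (α β : SignMatching ε) : Diagram ι :=
  fun p => if p.2 = 1 then (α.partner p.1, 1) else (β.partner p.1, -1)

/-- The set `S_{𝔞,𝔟}`: matched positions carry inverse letters, and no position labelled `R` is
matched with a position labelled `R⁻¹`. -/
def admissibleMatchings {ι X : Type} (a : ι → Letter X) (b : ι → BdryLabel) :
    Set (SignMatching (arcSign a)) :=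
  {α | (∀ v, a (α v).1 = (a v.1).inv) ∧
    ∀ v, ¬(b v.1 = BdryLabel.R ∧ b (α v).1 = BdryLabel.Rinv) ∧
      ¬(b v.1 = BdryLabel.Rinv ∧ b (α v).1 = BdryLabel.R)}

/-! ### Brauer maps and their surfaces -/

/-- A Brauer map `(τ_u, π, τ_b, φ)` with arc colouring `a` and boundary colouring `b`, where
`φ = π_{α,β}`. -/
structure BrauerMap {ι X : Type} (a : ι → Letter X) (b : ι → BdryLabel) where
  /-- `τ_u` -/
  upper : Diagram ι
  /-- `π` -/
  middle : Diagram ι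
  /-- `τ_b` -/
  lower : Diagram ι
  /-- the matching of the top vertices of `φ` -/
  α : SignMatching (arcSign a)
  /-- the matching of the bottom vertices of `φ` -/
  β : SignMatching (arcSign a)
  upper_mem : upper ∈ compatibleDiagrams a b
  middle_mem : middle ∈ walledDiagrams (arcSign a)
  lower_mem : lower ∈ compatibleDiagrams a b

namespace BrauerMap

variable {ι X : Type} {a : ι → Letter X} {b : ι → BdryLabel}

/-- The horizontal diagram `φ = π_{α,β}`. -/
def phi (𝔪 : BrauerMap a b) : Diagram ι := horizontalDiagram 𝔪.α 𝔪.β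

/-- `h(𝔪) = h(τ_u) + h(τ_b)`. -/
noncomputable def h (𝔪 : BrauerMap a b) : ℕ :=
  horizontalCount 𝔪.upper + horizontalCount 𝔪.lower

/-- Admissibility: `φ = π_{α,β}` with `α, β ∈ S_{𝔞,𝔟}`, and `τ_u`, `τ_b` are the identity diagram on
the strands labelled `W` or `W⁻¹`. -/
def IsAdmissible (𝔪 : BrauerMap a b) : Prop :=
  𝔪.α ∈ admissibleMatchings a b ∧ 𝔪.β ∈ admissibleMatchings a b ∧
    ∀ v, b v = BdryLabel.W ∨ b v = BdryLabel.Winv →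
      ∀ η, 𝔪.upper (v, η) = (v, -η) ∧ 𝔪.lower (v, η) = (v, -η)

/-- The 0-cells of `X_𝔪`: the set `ι × {-2, -1, 0, 1, 2}` with `(i, 2)` and `(i, -2)` identified,
that is, levels are taken modulo `4`. -/
abbrev ZeroCell (_𝔪 : BrauerMap a b) : Type := ι × ZMod 4

/-- A vertex of a diagram drawn between the levels `l` and `l + 1`. -/
def place (l : ZMod 4) (p : ι × ℤˣ) : ι × ZMod 4 := (p.1, if p.2 = 1 then l + 1 else l)

/-- The 1-cells of `X_𝔪`: the `τ_u`-, `π`-, `τ_b`- and `φ`-intervals, and one vertical interval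
(`ι`-interval) from `(x, -2)` to `(x, -1)` for every position `x`. -/
abbrev OneCell (𝔪 : BrauerMap a b) : Type :=
  strings 𝔪.upper ⊕ strings 𝔪.middle ⊕ strings 𝔪.lower ⊕ strings 𝔪.phi ⊕ ι

/-- Two 0-cells are the endpoints of a `τ_u`-interval (levels `1, 2`), a `π`-interval (levels
`0, 1`), a `τ_b`-interval (levels `-1, 0`) or a `φ`-interval (levels `-2, -1`). -/
def StringAdj (𝔪 : BrauerMap a b) (x y : 𝔪.ZeroCell) : Prop :=
  ∃ p, (x = place 1 p ∧ y = place 1 (𝔪.upper p)) ∨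
    (x = place 0 p ∧ y = place 0 (𝔪.middle p)) ∨
    (x = place (-1) p ∧ y = place (-1) (𝔪.lower p)) ∨
    (x = place (-2) p ∧ y = place (-2) (𝔪.phi p))

/-- The `𝒞_I`-circles: connected components of the union of the `τ`-, `π`- and `φ`-intervals. -/
abbrev CircleI (𝔪 : BrauerMap a b) : Type := Quot 𝔪.StringAdj

/-- Two vertices of `φ` are the endpoints of a `φ`-interval or of a vertical interval. -/
def CapAdj (𝔪 : BrauerMap a b) (p q : ι × ℤˣ) : Prop := q = 𝔪.phi p ∨ q = (p.1, -p.2)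

/-- The `𝒞_{II}`-circles: connected components of the union of the `φ`- and vertical intervals, a
graph on the vertices of levels `-2` and `-1`. -/
abbrev CircleII (𝔪 : BrauerMap a b) : Type := Quot 𝔪.CapAdj

/-- The 2-cells of `X_𝔪`: one disc glued along each `𝒞_I`-circle and each `𝒞_{II}`-circle. -/
abbrev TwoCell (𝔪 : BrauerMap a b) : Type := 𝔪.CircleI ⊕ 𝔪.CircleII

/-- The Euler characteristic `χ(Σ_𝔪)` of the total space of the finite 2-dimensional CW complex
`X_𝔪`. -/
noncomputable def eulerChar (𝔪 : BrauerMap a b) : ℤ :=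
  (Nat.card 𝔪.ZeroCell : ℤ) - (Nat.card 𝔪.OneCell : ℤ) + (Nat.card 𝔪.TwoCell : ℤ)

end BrauerMap

/-! ### Surface groups -/

/-- The generators `a_i` (`Sum.inl i`) and `b_i` (`Sum.inr i`). -/
abbrev SurfaceGen (g : ℕ) : Type := Fin g ⊕ Fin g

/-- The word `[a_1 b_1] ⋯ [a_g b_g]` with `[x y] = x y x⁻¹ y⁻¹`. -/
def surfaceWord (g : ℕ) : List (Letter (SurfaceGen g)) :=
  (List.finRange g).flatMap fun i =>
    [(Sum.inl i, true), (Sum.inr i, true), (Sum.inl i, false), (Sum.inr i, false)]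

/-- The surface group `Γ_g = ⟨a_1, b_1, …, a_g, b_g | [a_1 b_1] ⋯ [a_g b_g]⟩`. -/
abbrev SurfaceGroup (g : ℕ) : Type := PresentedGroup {FreeGroup.mk (surfaceWord g)}

/-- The element of `Γ_g` represented by a word. -/
def wordValue (g : ℕ) (w : List (Letter (SurfaceGen g))) : SurfaceGroup g :=
  PresentedGroup.mk _ (FreeGroup.mk w)

/-- `w` has least length among all words representing an element conjugate in `Γ_g` to the element
represented by `w`. -/
def IsCyclicallyShortest (g : ℕ) (w : List (Letter (SurfaceGen g))) : Prop :=
  ∀ w' : List (Letter (SurfaceGen g)),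
    IsConj (wordValue g w) (wordValue g w') → w.length ≤ w'.length

end WalledBrauer

open WalledBrauer

/-!
The proof reduces the Euler characteristic to a count of vertices in a glued surface, and then uses
combinatorial curvature, with a shortest word playing the role of a geodesic.

*Reduction.* Let `N` be the number of positions. The surface has `4 N` vertices and `5 N` edges, so
only the circles have to be counted. There are `N / 2` circles of the second kind if `α = β`. Since
the number of connected components of a graph is a submodular function of its edges
(`card_quot_exchange`), replacing `α` by `β` loses at most as many circles of the first kind as
there are circles of the second kind missing from `N / 2`. Similarly `τ_u` and `τ_b` can be replaced
by colour-preserving permutations at the cost of one circle for each top horizontal string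
(`exists_straightening`). Then the circles of the first kind are the cycles of the permutation
`ι ∘ T`, where `T` carries a letter to the next one on its word and `ι` is the involution defined by
`β` (`eulerChar_le_of_cycles`). In other words, they are the vertices of a surface glued from
boundary circles that read `w`, `w⁻¹`, powers of `r` and powers of `r⁻¹`, in which no `r` is glued
to an `r⁻¹`. The claim becomes that there are at most `(2 g - 1) (n + m) + |w|` of them.

*Discharging.* Every corner of a letter of `w` or `w⁻¹` has weight `1 / 2`, and every corner of a
relator has weight `1 / 2 - 1 / (4 g)`; the total is the bound above. A vertex that has weight less
than `1` consists of one word corner and one relator corner: two consecutive letters of the word are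
glued to the same relator disc. Such a corner receives a charge. A vertex with one word corner and
two relator corners, where the word passes to a neighbouring relator disc, gives its excess away,
and so does any other word corner next to an edge glued to a relator. Then every vertex has weight
at least `1` (`le_sum_dischargedWeight`).

*Geodesics.* It remains to see that the charges along each word have a sum of at most `0`
(`sum_charge_le`). A maximal stretch of the word that runs along relator discs has a row of discs on
its side; following the far side of this row gives another path with the same end points
(`exists_far_side`), or, if the row closes up to an annulus, a word for a conjugate element. The
difference of the two lengths is, up to the contribution of the two ends, the sum of the charges.
Hence the sum is bounded because the word is cyclically shortest. Only this easy direction of Dehn's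
algorithm is needed: no description of all shortest words is used.
-/

namespace WalledBrauer

/-! ### Signs, letters and labels -/

theorem units_ne_one_iff (x : ℤˣ) : x ≠ 1 ↔ x = -1 := by
  rcases Int.units_eq_one_or x with rfl | rfl <;> decide

theorem units_ne_neg_one_iff (x : ℤˣ) : x ≠ -1 ↔ x = 1 := by
  rcases Int.units_eq_one_or x with rfl | rfl <;> decide

theorem units_ne_iff_eq_neg (x y : ℤˣ) : x ≠ y ↔ x = -y := by
  rcases Int.units_eq_one_or x with rfl | rfl <;> rcases Int.units_eq_one_or y with rfl | rfl <;>
    decide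

theorem units_neg_ne_self (x : ℤˣ) : -x ≠ x := by
  rcases Int.units_eq_one_or x with rfl | rfl <;> decide

theorem Letter.inv_inv {X : Type} (l : Letter X) : l.inv.inv = l := by
  simp [Letter.inv]

theorem Letter.inv_ne {X : Type} (x : Letter X) : x.inv ≠ x := fun h => by
  have := congrArg Prod.snd h
  simp [Letter.inv] at this

theorem BdryLabel.inv_inv (l : BdryLabel) : l.inv.inv = l := by
  cases l <;> rfl

/-! ### Counting connected components by linear algebra -/

section Components

variable {V : Type*}

/-- The space of rational functions on `V` that are constant along a relation. Its dimension is the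
number of connected components, which turns inequalities between numbers of components into
inequalities between dimensions. -/
def invariantFunctions (r : V → V → Prop) : Submodule ℚ (V → ℚ) where
  carrier := {f | ∀ x y, r x y → f x = f y}
  add_mem' hf hg x y h := by simp [hf x y h, hg x y h]
  zero_mem' _ _ _ := rfl
  smul_mem' c f hf x y h := by simp [hf x y h]

/-- Invariant functions are the functions on the set of components. -/
noncomputable def invariantFunctionsEquiv (r : V → V → Prop) :
    invariantFunctions r ≃ₗ[ℚ] (Quot r → ℚ) where
  toFun f := Quot.lift f.1 f.2
  invFun F := ⟨fun x => F (Quot.mk r x), fun _ _ h => congrArg F (Quot.sound h)⟩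
  map_add' f g := by ext ⟨x⟩; rfl
  map_smul' c f := by ext ⟨x⟩; rfl
  left_inv f := rfl
  right_inv F := by ext ⟨x⟩; rfl

theorem finrank_invariantFunctions [Finite V] (r : V → V → Prop) :
    Module.finrank ℚ (invariantFunctions r) = Nat.card (Quot r) := by
  have := Fintype.ofFinite (Quot r)
  rw [(invariantFunctionsEquiv r).finrank_eq, Module.finrank_fintype_fun_eq_card,
    Nat.card_eq_fintype_card]

/-- Adding edges indexed by `K` lowers the number of components by at most the cardinality
of `K`. -/
theorem card_quot_le_add_card_edges [Finite V] {K : Type*} [Finite K] (r r' : V → V → Prop)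
    (e : K → V × V)
    (h : ∀ f ∈ invariantFunctions r, (∀ k, f (e k).1 = f (e k).2) → f ∈ invariantFunctions r') :
    Nat.card (Quot r) ≤ Nat.card (Quot r') + Nat.card K := by
  have := Fintype.ofFinite K
  let D : invariantFunctions r →ₗ[ℚ] (K → ℚ) :=
    { toFun := fun f k => f.1 (e k).1 - f.1 (e k).2
      map_add' := fun f g => by ext k; simp; ring
      map_smul' := fun c f => by ext k; simp; ring }
  have h1 := D.finrank_range_add_finrank_ker
  have h2 : Module.finrank ℚ (LinearMap.range D) ≤ Nat.card K := by
    refine (Submodule.finrank_le _).trans ?_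
    rw [Module.finrank_fintype_fun_eq_card, Nat.card_eq_fintype_card]
  have h3 : Module.finrank ℚ (LinearMap.ker D) ≤ Module.finrank ℚ (invariantFunctions r') := by
    let E : LinearMap.ker D →ₗ[ℚ] invariantFunctions r' :=
      LinearMap.codRestrict _ ((invariantFunctions r).subtype ∘ₗ (LinearMap.ker D).subtype)
        (fun f => h _ f.1.2 fun k => sub_eq_zero.1 (congrFun f.2 k))
    refine LinearMap.finrank_le_finrank_of_injective (f := E) fun f g hfg => ?_
    have hfg' : (E f).1 = (E g).1 := congrArg Subtype.val hfg
    exact Subtype.ext (Subtype.ext hfg')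
  rw [finrank_invariantFunctions] at h1 h3
  omega

/-- Submodularity of the number of components: exchanging a set `E` of edges on `Y` for a set `E'`
raises the number of components by at most the drop from `E` to `E ∪ E'`. -/
theorem card_quot_exchange [Finite V] {Y : Type*} [Finite Y] (p : Y → V) (r r' : V → V → Prop)
    (E E' : Y → Y → Prop)
    (hE : ∀ f ∈ invariantFunctions r, f ∘ p ∈ invariantFunctions E)
    (hE' : ∀ f ∈ invariantFunctions r, f ∘ p ∈ invariantFunctions E' → f ∈ invariantFunctions r') :
    Nat.card (Quot r) + Nat.card (Quot fun x y => E x y ∨ E' x y) ≤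
      Nat.card (Quot r') + Nat.card (Quot E) := by
  set EE : Y → Y → Prop := fun x y => E x y ∨ E' x y with hEE
  let S : Submodule ℚ (invariantFunctions E) :=
    (invariantFunctions EE).comap (invariantFunctions E).subtype
  have hle : invariantFunctions EE ≤ invariantFunctions E := fun f hf x y h => hf x y (Or.inl h)
  have hS : Module.finrank ℚ S = Nat.card (Quot EE) := by
    rw [← finrank_invariantFunctions]
    exact (Submodule.comapSubtypeEquivOfLe hle).finrank_eq
  have hq := Submodule.finrank_quotient_add_finrank S
  let pull : invariantFunctions r →ₗ[ℚ] invariantFunctions E :=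
    LinearMap.codRestrict _ ((LinearMap.funLeft ℚ ℚ p) ∘ₗ (invariantFunctions r).subtype)
      (fun f => hE _ f.2)
  let D := S.mkQ ∘ₗ pull
  have h1 := D.finrank_range_add_finrank_ker
  have h2 : Module.finrank ℚ (LinearMap.range D) ≤ Module.finrank ℚ (invariantFunctions E ⧸ S) :=
    Submodule.finrank_le _
  have h3 : Module.finrank ℚ (LinearMap.ker D) ≤ Module.finrank ℚ (invariantFunctions r') := by
    let G : LinearMap.ker D →ₗ[ℚ] invariantFunctions r' :=
      LinearMap.codRestrict _ ((invariantFunctions r).subtype ∘ₗ (LinearMap.ker D).subtype)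
        (fun f => by
          refine hE' _ f.1.2 fun x y hxy => ?_
          have hf : S.mkQ (pull f.1) = 0 := f.2
          rw [Submodule.mkQ_apply, Submodule.Quotient.mk_eq_zero] at hf
          exact hf x y (Or.inr hxy))
    refine LinearMap.finrank_le_finrank_of_injective (f := G) fun f g hfg => ?_
    have hfg' : (G f).1 = (G g).1 := congrArg Subtype.val hfg
    exact Subtype.ext (Subtype.ext hfg')
  rw [finrank_invariantFunctions] at h1 h3 hq
  omega

end Components

/-! ### Straightening the diagrams of a Brauer map -/

/-- A bijection between two subsets that preserves a colouring extends to a permutation that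
preserves the colouring. -/
theorem exists_perm_extending {I C : Type*} [Finite I] (col : I → C) {p q : I → Prop}
    (e : {v // p v} ≃ {v // q v}) (he : ∀ v, col (e v).1 = col v.1) :
    ∃ σ : Equiv.Perm I, (∀ v, col (σ v) = col v) ∧ ∀ v : {v // p v}, σ v.1 = (e v).1 := by
  classical
  have := Fintype.ofFinite I
  have he' : ∀ v, col (e.symm v).1 = col v.1 := fun v => by
    rw [← he, Equiv.apply_symm_apply]
  let ec : ∀ c, {x : {v // col v = c} // p x.1} ≃ {x : {v // col v = c} // q x.1} := fun c =>
    { toFun := fun x => ⟨⟨(e ⟨x.1.1, x.2⟩).1, (he _).trans x.1.2⟩, (e ⟨x.1.1, x.2⟩).2⟩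
      invFun := fun x => ⟨⟨(e.symm ⟨x.1.1, x.2⟩).1, (he' _).trans x.1.2⟩, (e.symm ⟨x.1.1, x.2⟩).2⟩
      left_inv := fun x => by simp
      right_inv := fun x => by simp }
  let F : ∀ c, Equiv.Perm {v // col v = c} := fun c => (ec c).extendSubtype
  let f : I → I := fun v => (F (col v) ⟨v, rfl⟩).1
  have hcol : ∀ v, col (f v) = col v := fun v => (F (col v) ⟨v, rfl⟩).2
  have hF : ∀ c v (h : col v = c), f v = (F c ⟨v, h⟩).1 := by
    rintro _ v rfl; rfl
  have hinj : Function.Injective f := by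
    intro v v' h
    have hc : col v' = col v := by rw [← hcol v, ← hcol v', h]
    rw [hF _ v rfl, hF _ v' hc] at h
    exact congrArg Subtype.val ((F (col v)).injective (Subtype.ext h))
  refine ⟨Equiv.ofBijective f (Finite.injective_iff_bijective.1 hinj), hcol, fun v => ?_⟩
  exact congrArg Subtype.val ((ec (col v.1)).extendSubtype_apply_of_mem ⟨v.1, rfl⟩ v.2)

/-- A compatible diagram becomes the diagram of a colour-preserving permutation `σ` by means of
`horizontalCount τ` additional edges: a function that is constant along `τ` and along these edges
is constant along the diagram of `σ`. The permutation `σ` extends the vertical strings of `τ` and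
carries the bottom horizontal strings to the top ones. -/
theorem exists_straightening {I X : Type} [Finite I] {a : I → Letter X} {b : I → BdryLabel}
    {τ : Diagram I} (hτ : τ ∈ compatibleDiagrams a b) :
    ∃ σ : Equiv.Perm I, (∀ v, a (σ v) = a v) ∧ (∀ v, b (σ v) = b v) ∧
      (∀ v, τ (v, -1) = (v, 1) → σ v = v) ∧
      ∃ (K : Type) (_ : Finite K) (e : K → (I × ℤˣ) × (I × ℤˣ)),
        Nat.card K ≤ horizontalCount τ ∧
        ∀ f : I × ℤˣ → ℚ, (∀ p, f p = f (τ p)) → (∀ k, f (e k).1 = f (e k).2) →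
          ∀ v, f (v, -1) = f (σ v, 1) := by
  obtain ⟨⟨hinv, hfix, hsgn⟩, hvert, hhor⟩ := hτ
  -- `dn v` and `up v` are the positions matched with the bottom and the top vertex at `v`.
  let dn : I → I := fun v => (τ (v, -1)).1
  let up : I → I := fun v => (τ (v, 1)).1
  have hdv : ∀ v, (τ (v, -1)).2 = 1 → τ (v, -1) = (dn v, 1) := fun v h => Prod.ext rfl h
  have hdh : ∀ v, (τ (v, -1)).2 = -1 → τ (v, -1) = (dn v, -1) := fun v h => Prod.ext rfl h
  have huv : ∀ v, (τ (v, 1)).2 = -1 → τ (v, 1) = (up v, -1) := fun v h => Prod.ext rfl h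
  have huh : ∀ v, (τ (v, 1)).2 = 1 → τ (v, 1) = (up v, 1) := fun v h => Prod.ext rfl h
  have hdv' : ∀ v, (τ (v, -1)).2 = 1 → τ (dn v, 1) = (v, -1) := fun v h => by
    rw [← hdv v h, hinv]
  have hdh' : ∀ v, (τ (v, -1)).2 = -1 → τ (dn v, -1) = (v, -1) := fun v h => by
    rw [← hdh v h, hinv]
  have huv' : ∀ v, (τ (v, 1)).2 = -1 → τ (up v, -1) = (v, 1) := fun v h => by
    rw [← huv v h, hinv]
  have huh' : ∀ v, (τ (v, 1)).2 = 1 → τ (up v, 1) = (v, 1) := fun v h => by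
    rw [← huh v h, hinv]
  let e : {v // (τ (v, -1)).2 = 1} ≃ {v // (τ (v, 1)).2 = -1} :=
    { toFun := fun v => ⟨dn v.1, by rw [hdv' v.1 v.2]⟩
      invFun := fun v => ⟨up v.1, by rw [huv' v.1 v.2]⟩
      left_inv := fun v => Subtype.ext (by
        show (τ (dn v.1, 1)).1 = v.1
        rw [hdv' v.1 v.2])
      right_inv := fun v => Subtype.ext (by
        show (τ (up v.1, -1)).1 = v.1
        rw [huv' v.1 v.2]) }
  have hecol : ∀ v, (fun v => (a v, b v)) (e v).1 = (fun v => (a v, b v)) v.1 := fun v =>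
    Prod.ext (hvert _ _ (hdv v.1 v.2)).1 (hvert _ _ (hdv v.1 v.2)).2
  obtain ⟨σ, hσcol, hσe⟩ := exists_perm_extending (fun v => (a v, b v)) e hecol
  have hσa : ∀ v, a (σ v) = a v := fun v => congrArg Prod.fst (hσcol v)
  have hσb : ∀ v, b (σ v) = b v := fun v => congrArg Prod.snd (hσcol v)
  have hσv : ∀ v, (τ (v, -1)).2 = 1 → σ v = dn v := fun v h => hσe ⟨v, h⟩
  have hσt : ∀ v, (τ (v, -1)).2 = 1 → (τ (σ v, 1)).2 = -1 := fun v h => by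
    rw [hσv v h, hdv' v h]
  have hσh : ∀ v, (τ (v, -1)).2 = -1 → (τ (σ v, 1)).2 = 1 := fun v h => by
    by_contra hc
    rw [← ne_eq, units_ne_one_iff] at hc
    have h1 := hσe (e.symm ⟨σ v, hc⟩)
    rw [Equiv.apply_symm_apply] at h1
    have h2 := (e.symm ⟨σ v, hc⟩).2
    rw [σ.injective h1, h] at h2
    exact absurd h2 (by decide)
  have hdn : ∀ v, (τ (v, -1)).2 = -1 → (τ (dn v, -1)).2 = -1 := fun v h => by rw [hdh' v h]
  have hεd : ∀ v, (τ (v, -1)).2 = -1 → arcSign a (dn v) = -arcSign a v := fun v h => by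
    show (a (dn v)).sign = _
    rw [(hhor _ _ _ (hdh v h)).1, Letter.sign_inv]; rfl
  have hεu : ∀ v, (τ (v, 1)).2 = 1 → arcSign a (up v) = -arcSign a v := fun v h => by
    show (a (up v)).sign = _
    rw [(hhor _ _ _ (huh v h)).1, Letter.sign_inv]; rfl
  have hεσ : ∀ v, arcSign a (σ v) = arcSign a v := fun v => by
    show (a (σ v)).sign = _
    rw [hσa]; rfl
  classical
  -- At the negative positions with a bottom horizontal string, `σ` is replaced by its conjugate by
  -- `τ`, so that bottom horizontal strings go to top ones and one edge per string suffices.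
  let flip : I → Prop := fun v => (τ (v, -1)).2 = -1 ∧ arcSign a v = -1
  let ρ : I → I := fun v => if flip v then up (σ (dn v)) else σ v
  have hρ1 : ∀ v, flip v → ρ v = up (σ (dn v)) := fun v h => if_pos h
  have hρ2 : ∀ v, ¬flip v → ρ v = σ v := fun v h => if_neg h
  have hρt : ∀ v, flip v → (τ (ρ v, 1)).2 = 1 := fun v h => by
    rw [hρ1 v h, huh' _ (hσh _ (hdn _ h.1))]
  have hρε : ∀ v, arcSign a (ρ v) = arcSign a v := fun v => by
    by_cases h : flip v
    · rw [hρ1 v h, hεu _ (hσh _ (hdn _ h.1)), hεσ, hεd _ h.1, neg_neg]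
    · rw [hρ2 v h, hεσ]
  have hmix : ∀ v v', flip v → ¬flip v' → ρ v ≠ ρ v' := fun v v' h h' heq => by
    have h1 := hρt v h
    have h2 := hρε v'
    rw [← heq, hρε, h.2] at h2
    have h3 : (τ (v', -1)).2 = 1 := by
      by_contra hc
      exact h' ⟨(units_ne_one_iff _).1 hc, h2.symm⟩
    rw [heq, hρ2 v' h', hσt v' h3] at h1
    exact absurd h1 (by decide)
  have hρinj : Function.Injective ρ := by
    intro v v' heq
    by_cases h : flip v <;> by_cases h' : flip v'
    · rw [hρ1 v h, hρ1 v' h'] at heq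
      have h1 := huh' _ (hσh _ (hdn _ h.1))
      rw [heq, huh' _ (hσh _ (hdn _ h'.1))] at h1
      have h2 := σ.injective (congrArg Prod.fst h1)
      have h3 := hdh' _ h.1
      rw [← h2, hdh' _ h'.1] at h3
      exact (congrArg Prod.fst h3).symm
    · exact absurd heq (hmix v v' h h')
    · exact absurd heq.symm (hmix v' v h' h)
    · rw [hρ2 v h, hρ2 v' h'] at heq
      exact σ.injective heq
  refine ⟨Equiv.ofBijective ρ (Finite.injective_iff_bijective.1 hρinj), fun v => ?_, fun v => ?_,
    fun v hv => ?_, {v // arcSign a v = 1 ∧ (τ (v, 1)).2 = 1}, inferInstance,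
    fun v => ((σ.symm v.1, -1), (v.1, 1)), ?_, fun f hf hk v => ?_⟩
  · show a (ρ v) = a v
    by_cases h : flip v
    · rw [hρ1 v h, (hhor _ _ _ (huh _ (hσh _ (hdn _ h.1)))).1, hσa, (hhor _ _ _ (hdh _ h.1)).1,
        Letter.inv_inv]
    · rw [hρ2 v h, hσa]
  · show b (ρ v) = b v
    by_cases h : flip v
    · rw [hρ1 v h, (hhor _ _ _ (huh _ (hσh _ (hdn _ h.1)))).2, hσb, (hhor _ _ _ (hdh _ h.1)).2,
        BdryLabel.inv_inv]
    · rw [hρ2 v h, hσb]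
  · show ρ v = v
    have h1 : (τ (v, -1)).2 = 1 := by rw [hv]
    have h : ¬flip v := fun h => by
      rw [h.1] at h1
      exact absurd h1 (by decide)
    rw [hρ2 v h, hσv v h1]
    show (τ (v, -1)).1 = v
    rw [hv]
  · -- A top string is determined by its end of positive sign.
    let s : {v // arcSign a v = 1 ∧ (τ (v, 1)).2 = 1} → {e ∈ strings τ | ∀ p ∈ e, p.2 = 1} :=
      fun v => ⟨s((v.1, 1), τ (v.1, 1)), ⟨⟨(v.1, 1), rfl⟩, fun p hp => by
        rcases Sym2.mem_iff.1 hp with rfl | rfl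
        · rfl
        · exact v.2.2⟩⟩
    have hs : Function.Injective s := by
      intro v v' heq
      have h1 : s((v.1, (1 : ℤˣ)), τ (v.1, 1)) = s((v'.1, (1 : ℤˣ)), τ (v'.1, 1)) :=
        congrArg Subtype.val heq
      rcases Sym2.eq_iff.1 h1 with ⟨h2, -⟩ | ⟨h2, -⟩
      · exact Subtype.ext (congrArg Prod.fst h2)
      · have h3 := hεu v'.1 v'.2.2
        have h4 : up v'.1 = v.1 := (congrArg Prod.fst h2).symm
        rw [h4, v.2.1, v'.2.1] at h3
        exact absurd h3 (by decide)
    have := Nat.card_le_card_of_injective s hs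
    rwa [Nat.card_coe_set_eq] at this
  · show f (v, -1) = f (ρ v, 1)
    by_cases hb : (τ (v, -1)).2 = 1
    · rw [hρ2 v (fun h => absurd (hb.symm.trans h.1) (by decide)), hσv v hb, hf (v, -1), hdv v hb]
    · rw [← ne_eq, units_ne_one_iff] at hb
      by_cases hs : arcSign a v = -1
      · have h : flip v := ⟨hb, hs⟩
        have h1 := hσh _ (hdn _ hb)
        have h2 := hk ⟨σ (dn v), by rw [hεσ, hεd _ hb, hs, neg_neg], h1⟩
        simp only [Equiv.symm_apply_apply] at h2
        rw [hρ1 v h, hf (v, -1), hdh v hb, h2, hf (σ (dn v), 1), huh _ h1]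
      · rw [hρ2 v fun h => hs h.2]
        rw [← ne_eq, units_ne_neg_one_iff] at hs
        have h2 := hk ⟨σ v, by rw [hεσ, hs], hσh _ hb⟩
        simpa only [Equiv.symm_apply_apply] using h2

/-! ### Reduction to the cycles of a permutation -/

section Reduction

variable {I X : Type}

theorem partner_of_neg {ε : I → ℤˣ} (α : SignMatching ε) {v : I} (h : ε v = -1) :
    α.partner v = (α ⟨v, h⟩ : I) := dif_pos h

theorem partner_of_pos {ε : I → ℤˣ} (α : SignMatching ε) {v : I} (h : ε v = 1) :
    α.partner v = (α.symm ⟨v, h⟩ : I) := dif_neg (by rw [h]; decide)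

theorem sign_partner {ε : I → ℤˣ} (α : SignMatching ε) (v : I) :
    ε (α.partner v) = -ε v := by
  rcases Int.units_eq_one_or (ε v) with h | h
  · rw [partner_of_pos α h, (α.symm ⟨v, h⟩).2, h]
  · rw [partner_of_neg α h, (α ⟨v, h⟩).2, h, neg_neg]

theorem partner_partner {ε : I → ℤˣ} (α : SignMatching ε) (v : I) :
    α.partner (α.partner v) = v := by
  rcases Int.units_eq_one_or (ε v) with h | h
  · have h' : ε (α.symm ⟨v, h⟩ : I) = -1 := (α.symm ⟨v, h⟩).2
    rw [partner_of_pos α h, partner_of_neg α h']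
    simp
  · have h' : ε (α ⟨v, h⟩ : I) = 1 := (α ⟨v, h⟩).2
    rw [partner_of_neg α h, partner_of_pos α h']
    simp

/-- The involution of the positions defined by an element of `S_ε`. -/
def partnerPerm {ε : I → ℤˣ} (α : SignMatching ε) : Equiv.Perm I :=
  ⟨α.partner, α.partner, partner_partner α, partner_partner α⟩

theorem horizontalDiagram_mem {ε : I → ℤˣ} (α β : SignMatching ε) :
    horizontalDiagram α β ∈ walledDiagrams ε := by
  refine ⟨?_, ?_, ?_⟩ <;> rintro ⟨v, η⟩ <;> rcases Int.units_eq_one_or η with rfl | rfl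
  · simp [horizontalDiagram, partner_partner]
  · simp [horizontalDiagram, partner_partner]
  · intro h
    have h1 := congrArg (fun p => ε p.1) h
    simp only [horizontalDiagram, if_true, sign_partner] at h1
    exact units_neg_ne_self (ε v) h1
  · intro h
    have h1 := congrArg (fun p => ε p.1) h
    simp only [horizontalDiagram, if_neg (show (-1 : ℤˣ) ≠ 1 by decide), sign_partner] at h1
    exact units_neg_ne_self (ε v) h1
  · simp [horizontalDiagram, sign_partner]
  · simp [horizontalDiagram, sign_partner]

/-- A walled diagram has one string through `(v, ε(v))` for each position `v`, and these strings are
distinct. -/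
theorem card_le_card_strings [Finite I] {ε : I → ℤˣ} {π : Diagram I} (h : π ∈ walledDiagrams ε) :
    Nat.card I ≤ Nat.card (strings π) := by
  refine Nat.card_le_card_of_injective
    (fun v => (⟨s((v, ε v), π (v, ε v)), ⟨_, rfl⟩⟩ : strings π)) fun v v' heq => ?_
  have h1 : s((v, ε v), π (v, ε v)) = s((v', ε v'), π (v', ε v')) := congrArg Subtype.val heq
  rcases Sym2.eq_iff.1 h1 with ⟨h2, -⟩ | ⟨h2, -⟩
  · exact congrArg Prod.fst h2
  · have h3 := h.2.2 (v', ε v')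
    rw [← h2] at h3
    simp only [Int.units_mul_self] at h3
    exact absurd h3 (by decide)

theorem place_high (l : ZMod 4) (v : I) : BrauerMap.place l (v, 1) = (v, l + 1) := by
  simp [BrauerMap.place]

theorem place_low (l : ZMod 4) (v : I) : BrauerMap.place l (v, -1) = (v, l) := by
  simp [BrauerMap.place]

/-- The relation generated by the intervals of four diagrams drawn at the levels of a Brauer map;
its classes are the `𝒞_I`-circles. -/
def circleAdj (u m l φ : Diagram I) (x y : I × ZMod 4) : Prop :=
  ∃ p, (x = BrauerMap.place 1 p ∧ y = BrauerMap.place 1 (u p)) ∨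
    (x = BrauerMap.place 0 p ∧ y = BrauerMap.place 0 (m p)) ∨
    (x = BrauerMap.place (-1) p ∧ y = BrauerMap.place (-1) (l p)) ∨
    (x = BrauerMap.place (-2) p ∧ y = BrauerMap.place (-2) (φ p))

theorem forall_circleAdj_iff {Z : Type*} {u m l φ : Diagram I} {f : I × ZMod 4 → Z} :
    (∀ x y, circleAdj u m l φ x y → f x = f y) ↔
      (∀ p, f (BrauerMap.place 1 p) = f (BrauerMap.place 1 (u p))) ∧
      (∀ p, f (BrauerMap.place 0 p) = f (BrauerMap.place 0 (m p))) ∧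
      (∀ p, f (BrauerMap.place (-1) p) = f (BrauerMap.place (-1) (l p))) ∧
      (∀ p, f (BrauerMap.place (-2) p) = f (BrauerMap.place (-2) (φ p))) := by
  constructor
  · intro h
    exact ⟨fun p => h _ _ ⟨p, Or.inl ⟨rfl, rfl⟩⟩, fun p => h _ _ ⟨p, Or.inr (Or.inl ⟨rfl, rfl⟩)⟩,
      fun p => h _ _ ⟨p, Or.inr (Or.inr (Or.inl ⟨rfl, rfl⟩))⟩,
      fun p => h _ _ ⟨p, Or.inr (Or.inr (Or.inr ⟨rfl, rfl⟩))⟩⟩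
  · rintro ⟨h1, h2, h3, h4⟩ x y ⟨p, ⟨rfl, rfl⟩ | ⟨rfl, rfl⟩ | ⟨rfl, rfl⟩ | ⟨rfl, rfl⟩⟩
    exacts [h1 p, h2 p, h3 p, h4 p]

theorem forall_permDiagram {Z : Type*} {σ : Equiv.Perm I} {f : I × ℤˣ → Z}
    (h : ∀ v, f (v, -1) = f (σ v, 1)) (p : I × ℤˣ) : f p = f (permDiagram σ p) := by
  obtain ⟨v, η⟩ := p
  rcases Int.units_eq_one_or η with rfl | rfl
  · simp [permDiagram, h]
  · simp [permDiagram, h]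

/-- Replacing `α` by `β` costs as many `𝒞_I`-circles as there are `𝒞_{II}`-circles missing from the
maximal number `|I| / 2`. -/
theorem card_circles_le_of_exchange [Finite I] {a : I → Letter X} {b : I → BdryLabel}
    (𝔪 : BrauerMap a b) :
    Nat.card 𝔪.CircleI + Nat.card 𝔪.CircleII ≤
      Nat.card (Quot (circleAdj 𝔪.upper 𝔪.middle 𝔪.lower (horizontalDiagram 𝔪.β 𝔪.β))) +
        Nat.card {v // arcSign a v = 1} := by
  have key := card_quot_exchange (fun v : I => BrauerMap.place (-2) (v, 1))
    (circleAdj 𝔪.upper 𝔪.middle 𝔪.lower 𝔪.phi)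
    (circleAdj 𝔪.upper 𝔪.middle 𝔪.lower (horizontalDiagram 𝔪.β 𝔪.β))
    (fun x y => y = 𝔪.α.partner x) (fun x y => y = 𝔪.β.partner x)
    (fun f hf => by
      rintro x _ rfl
      have := (forall_circleAdj_iff.1 hf).2.2.2 (x, 1)
      simpa [BrauerMap.phi, horizontalDiagram] using this)
    (fun f hf hf' => by
      obtain ⟨h1, h2, h3, h4⟩ := forall_circleAdj_iff.1 hf
      refine forall_circleAdj_iff.2 ⟨h1, h2, h3, ?_⟩
      rintro ⟨v, η⟩
      rcases Int.units_eq_one_or η with rfl | rfl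
      · simpa [horizontalDiagram] using hf' v _ rfl
      · simpa [BrauerMap.phi, horizontalDiagram] using h4 (v, -1))
  have hI : Nat.card 𝔪.CircleI =
    Nat.card (Quot (circleAdj 𝔪.upper 𝔪.middle 𝔪.lower 𝔪.phi)) := rfl
  have hII : Nat.card 𝔪.CircleII ≤
      Nat.card (Quot fun x y => y = 𝔪.α.partner x ∨ y = 𝔪.β.partner x) := by
    have hv : ∀ v η, Quot.mk 𝔪.CapAdj (v, η) = Quot.mk 𝔪.CapAdj (v, -η) := fun v η =>
      Quot.sound (Or.inr rfl)
    have hp : ∀ p, Quot.mk 𝔪.CapAdj p = Quot.mk 𝔪.CapAdj (𝔪.phi p) := fun p =>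
      Quot.sound (Or.inl rfl)
    refine Nat.card_le_card_of_surjective
      (Quot.lift (fun v => Quot.mk 𝔪.CapAdj (v, 1)) ?_) ?_
    · rintro v _ (rfl | rfl)
      · simpa [BrauerMap.phi, horizontalDiagram] using hp (v, 1)
      · rw [hv v, hv (𝔪.β.partner v)]
        simpa [BrauerMap.phi, horizontalDiagram] using hp (v, -1)
    · rintro ⟨v, η⟩
      refine ⟨Quot.mk _ v, ?_⟩
      rcases Int.units_eq_one_or η with rfl | rfl
      · rfl
      · exact hv v 1
  have hE : Nat.card (Quot fun x y => y = 𝔪.α.partner x) ≤ Nat.card {v // arcSign a v = 1} := by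
    refine Nat.card_le_card_of_surjective (fun v => Quot.mk _ v.1) ?_
    rintro ⟨v⟩
    rcases Int.units_eq_one_or (arcSign a v) with h | h
    · exact ⟨⟨v, h⟩, rfl⟩
    · refine ⟨⟨𝔪.α.partner v, by rw [sign_partner 𝔪.α v, h, neg_neg]⟩, ?_⟩
      exact (Quot.sound (r := fun x y => y = 𝔪.α.partner x) rfl).symm
  omega

/-- The permutation carrying `v` to the position at the other end of the string of a walled diagram
that starts at `(v, -ε(v))`: for `π_w` it carries every letter to the next one. -/
def walledStep {ε : I → ℤˣ} {π : Diagram I} (h : π ∈ walledDiagrams ε) : Equiv.Perm I where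
  toFun v := (π (v, -ε v)).1
  invFun v := (π (v, ε v)).1
  left_inv v := by
    have h3 := h.2.2 (v, -ε v)
    simp only [mul_neg, Int.units_mul_self, neg_neg] at h3
    have h4 : π (v, -ε v) = ((π (v, -ε v)).1, ε (π (v, -ε v)).1) :=
      Prod.ext rfl (mul_left_cancel (h3.trans (Int.units_mul_self _).symm))
    simp only
    rw [← h4, h.1]
  right_inv v := by
    have h3 := h.2.2 (v, ε v)
    simp only [Int.units_mul_self] at h3
    have h4 : π (v, ε v) = ((π (v, ε v)).1, -ε (π (v, ε v)).1) :=
      Prod.ext rfl (mul_left_cancel (h3.trans (by rw [mul_neg, Int.units_mul_self])))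
    simp only
    rw [← h4, h.1]

theorem walledStep_spec {ε : I → ℤˣ} {π : Diagram I} (h : π ∈ walledDiagrams ε) (v : I) :
    π (v, -ε v) = (walledStep h v, ε (walledStep h v)) := by
  have h3 := h.2.2 (v, -ε v)
  simp only [mul_neg, Int.units_mul_self, neg_neg] at h3
  exact Prod.ext rfl (mul_left_cancel (h3.trans (Int.units_mul_self _).symm))

/-- Two sign-preserving permutations, one applied at the positive and the other at the negative
positions. -/
def signPerm {ε : I → ℤˣ} (σ σ' : Equiv.Perm I) (h : ∀ v, ε (σ v) = ε v)
    (h' : ∀ v, ε (σ' v) = ε v) : Equiv.Perm I where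
  toFun v := if ε v = 1 then σ v else σ' v
  invFun v := if ε v = 1 then σ.symm v else σ'.symm v
  left_inv v := by
    by_cases hv : ε v = 1 <;> simp [hv, h, h']
  right_inv v := by
    have k : ε (σ.symm v) = ε v := by rw [← h, Equiv.apply_symm_apply]
    have k' : ε (σ'.symm v) = ε v := by rw [← h', Equiv.apply_symm_apply]
    by_cases hv : ε v = 1 <;> simp [hv, k, k']

theorem signPerm_of_pos {ε : I → ℤˣ} {σ σ' : Equiv.Perm I} (h : ∀ v, ε (σ v) = ε v)
    (h' : ∀ v, ε (σ' v) = ε v) {v : I} (hv : ε v = 1) : signPerm σ σ' h h' v = σ v := if_pos hv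

theorem signPerm_of_neg {ε : I → ℤˣ} {σ σ' : Equiv.Perm I} (h : ∀ v, ε (σ v) = ε v)
    (h' : ∀ v, ε (σ' v) = ε v) {v : I} (hv : ε v = -1) : signPerm σ σ' h h' v = σ' v :=
  if_neg (by rw [hv]; decide)

/-- If the diagrams next to the middle one are those of permutations, then every `𝒞_I`-circle
alternately traverses the middle part, from the end of a letter to the start of the next one, and
a string of `φ`. Hence the circles correspond to the cycles of the composite permutation. -/
theorem card_quot_circleAdj_le [Finite I] {ε : I → ℤˣ} {m : Diagram I} (hm : m ∈ walledDiagrams ε)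
    (σu σl : Equiv.Perm I) (hu : ∀ v, ε (σu v) = ε v) (hl : ∀ v, ε (σl v) = ε v)
    (hu' : ∀ v, ε (σu.symm v) = ε v) (hl' : ∀ v, ε (σl.symm v) = ε v) (β : SignMatching ε) :
    Nat.card (Quot (circleAdj (permDiagram σu) m (permDiagram σl) (horizontalDiagram β β))) ≤
      Nat.card (Quot fun x y => y = β.partner (signPerm σu σl.symm hu hl'
        (walledStep hm (signPerm σl σu.symm hl hu' x)))) := by
  set r := circleAdj (permDiagram σu) m (permDiagram σl) (horizontalDiagram β β) with hr
  set ρi := signPerm σu σl.symm hu hl' with hρi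
  set ρo := signPerm σl σu.symm hl hu' with hρo
  set st := walledStep hm
  obtain ⟨h1, h2, h3, h4⟩ := (forall_circleAdj_iff (f := Quot.mk r)).1 fun x y h => Quot.sound h
  -- `cut` is the vertex of `φ`, and `mid` the vertex of the middle diagram.
  let cut : I × ℤˣ → Quot r := fun p => Quot.mk r (BrauerMap.place (-2) p)
  let mid : I × ℤˣ → Quot r := fun p => Quot.mk r (BrauerMap.place 0 p)
  have hU : ∀ v, mid (v, 1) = cut (σu v, -1) := fun v => by
    have := h1 (v, -1)
    rwa [show permDiagram σu (v, -1) = (σu v, 1) from if_pos rfl, place_low, place_high,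
      show (1 : ZMod 4) + 1 = -2 from rfl, ← place_low (-2),
      show (1 : ZMod 4) = 0 + 1 from rfl, ← place_high] at this
  have hL : ∀ v, cut (v, 1) = mid (σl v, -1) := fun v => by
    have := h3 (v, -1)
    rwa [show permDiagram σl (v, -1) = (σl v, 1) from if_pos rfl, place_low, place_high,
      show (-1 : ZMod 4) + 1 = 0 from rfl, show (-1 : ZMod 4) = -2 + 1 from rfl,
      ← place_high, ← place_low] at this
  have hφ : ∀ v η, cut (v, η) = cut (β.partner v, η) := fun v η => by
    rcases Int.units_eq_one_or η with rfl | rfl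
    · exact h4 (v, 1)
    · exact h4 (v, -1)
  have hout : ∀ v, cut (v, ε v) = mid (ρo v, -ε (ρo v)) := fun v => by
    rcases Int.units_eq_one_or (ε v) with h | h
    · rw [hρo, signPerm_of_pos hl hu' h, hl, h, hL]
    · rw [hρo, signPerm_of_neg hl hu' h, hu', h, neg_neg, hU, Equiv.apply_symm_apply]
  have hin : ∀ v, mid (v, ε v) = cut (ρi v, -ε (ρi v)) := fun v => by
    rcases Int.units_eq_one_or (ε v) with h | h
    · rw [hρi, signPerm_of_pos hu hl' h, hu, h, hU]
    · rw [hρi, signPerm_of_neg hu hl' h, hl', h, neg_neg, hL, Equiv.apply_symm_apply]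
  have hmid : ∀ v, mid (v, -ε v) = mid (st v, ε (st v)) := fun v => by
    have := h2 (v, -ε v)
    rw [walledStep_spec hm v] at this
    exact this
  have hcap : ∀ v, cut (v, -ε v) = cut (β.partner v, ε (β.partner v)) := fun v => by
    rw [sign_partner β v, ← hφ]
  refine Nat.card_le_card_of_surjective (Quot.lift (fun v => cut (v, ε v)) ?_) ?_
  · rintro v _ rfl
    show cut (v, ε v) = cut (β.partner _, ε (β.partner _))
    rw [hout, hmid, hin, hcap]
  · set q := Quot.lift (fun v => cut (v, ε v)) _ with hq
    have hq' : ∀ v, q (Quot.mk _ v) = cut (v, ε v) := fun v => rfl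
    have hc : ∀ p, ∃ y, q y = cut p := by
      rintro ⟨v, η⟩
      by_cases h : η = ε v
      · exact ⟨Quot.mk _ v, by rw [hq', h]⟩
      · refine ⟨Quot.mk _ (β.partner v), ?_⟩
        rw [hq', ← hcap, (units_ne_iff_eq_neg _ _).1 h]
    have hmd : ∀ p, ∃ y, q y = mid p := by
      rintro ⟨v, η⟩
      by_cases h : η = ε v
      · rw [h, hin]
        exact hc _
      · rw [show η = -ε v from (units_ne_iff_eq_neg _ _).1 h]
        have := hout (ρo.symm v)
        rw [Equiv.apply_symm_apply] at this
        rw [← this]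
        exact hc _
    rintro ⟨v, l⟩
    have hl4 : l = 0 ∨ l = 1 ∨ l = 2 ∨ l = 3 := by
      revert l; decide
    rcases hl4 with rfl | rfl | rfl | rfl
    · exact hmd (v, -1)
    · exact hmd (v, 1)
    · exact hc (v, -1)
    · exact hc (v, 1)

/-- The count of cells bounds the Euler characteristic of a Brauer map by the number of cycles of a
permutation, composed of the steps of the middle diagram, the matching `β`, and colour-preserving
permutations `ρ`, `ρ'` that straighten `τ_u` and `τ_b`. -/
theorem eulerChar_le_of_cycles [Finite I] {a : I → Letter X} {b : I → BdryLabel}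
    (𝔪 : BrauerMap a b) :
    ∃ ρ ρ' : Equiv.Perm I, (∀ v, a (ρ v) = a v ∧ b (ρ v) = b v) ∧
      (∀ v, a (ρ' v) = a v ∧ b (ρ' v) = b v) ∧
      (∀ v, (∀ η, 𝔪.upper (v, η) = (v, -η) ∧ 𝔪.lower (v, η) = (v, -η)) → ρ v = v ∧ ρ' v = v) ∧
      2 * 𝔪.eulerChar + Nat.card I ≤ 2 * 𝔪.h +
        2 * Nat.card (Quot fun x y =>
          y = 𝔪.β.partner (ρ (walledStep 𝔪.middle_mem (ρ' x)))) := by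
  obtain ⟨σu, hua, hub, hui, K, _, e, hK, he⟩ := exists_straightening 𝔪.upper_mem
  obtain ⟨σl, hla, hlb, hli, K', _, e', hK', he'⟩ := exists_straightening 𝔪.lower_mem
  have hu : ∀ v, arcSign a (σu v) = arcSign a v := fun v => congrArg Letter.sign (hua v)
  have hl : ∀ v, arcSign a (σl v) = arcSign a v := fun v => congrArg Letter.sign (hla v)
  have hua' : ∀ v, a (σu.symm v) = a v := fun v => by rw [← hua, Equiv.apply_symm_apply]
  have hla' : ∀ v, a (σl.symm v) = a v := fun v => by rw [← hla, Equiv.apply_symm_apply]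
  have hub' : ∀ v, b (σu.symm v) = b v := fun v => by rw [← hub, Equiv.apply_symm_apply]
  have hlb' : ∀ v, b (σl.symm v) = b v := fun v => by rw [← hlb, Equiv.apply_symm_apply]
  have hu' : ∀ v, arcSign a (σu.symm v) = arcSign a v := fun v => congrArg Letter.sign (hua' v)
  have hl' : ∀ v, arcSign a (σl.symm v) = arcSign a v := fun v => congrArg Letter.sign (hla' v)
  have hsign := Int.units_eq_one_or
  refine ⟨signPerm σu σl.symm hu hl', signPerm σl σu.symm hl hu', fun v => ?_, fun v => ?_,
    fun v hv => ?_, ?_⟩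
  · rcases hsign (arcSign a v) with h | h
    · rw [signPerm_of_pos hu hl' h]; exact ⟨hua v, hub v⟩
    · rw [signPerm_of_neg hu hl' h]; exact ⟨hla' v, hlb' v⟩
  · rcases hsign (arcSign a v) with h | h
    · rw [signPerm_of_pos hl hu' h]; exact ⟨hla v, hlb v⟩
    · rw [signPerm_of_neg hl hu' h]; exact ⟨hua' v, hub' v⟩
  · have h1 : σu v = v := hui v (by rw [(hv (-1)).1, neg_neg])
    have h2 : σl v = v := hli v (by rw [(hv (-1)).2, neg_neg])
    have h1' : σu.symm v = v := by rw [Equiv.symm_apply_eq, h1]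
    have h2' : σl.symm v = v := by rw [Equiv.symm_apply_eq, h2]
    rcases hsign (arcSign a v) with h | h
    · rw [signPerm_of_pos hu hl' h, signPerm_of_pos hl hu' h]; exact ⟨h1, h2⟩
    · rw [signPerm_of_neg hu hl' h, signPerm_of_neg hl hu' h]; exact ⟨h2', h1'⟩
  · have c1 := card_circles_le_of_exchange 𝔪
    have c2 := card_quot_le_add_card_edges
      (circleAdj 𝔪.upper 𝔪.middle 𝔪.lower (horizontalDiagram 𝔪.β 𝔪.β))
      (circleAdj (permDiagram σu) 𝔪.middle 𝔪.lower (horizontalDiagram 𝔪.β 𝔪.β))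
      (fun k => (BrauerMap.place 1 (e k).1, BrauerMap.place 1 (e k).2))
      (fun f hf hk => by
        obtain ⟨h1, h2, h3, h4⟩ := forall_circleAdj_iff.1 hf
        exact forall_circleAdj_iff.2 ⟨forall_permDiagram (f := fun p => f (BrauerMap.place 1 p))
          (he (fun p => f (BrauerMap.place 1 p)) h1 hk), h2, h3, h4⟩)
    have c3 := card_quot_le_add_card_edges
      (circleAdj (permDiagram σu) 𝔪.middle 𝔪.lower (horizontalDiagram 𝔪.β 𝔪.β))
      (circleAdj (permDiagram σu) 𝔪.middle (permDiagram σl) (horizontalDiagram 𝔪.β 𝔪.β))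
      (fun k => (BrauerMap.place (-1) (e' k).1, BrauerMap.place (-1) (e' k).2))
      (fun f hf hk => by
        obtain ⟨h1, h2, h3, h4⟩ := forall_circleAdj_iff.1 hf
        exact forall_circleAdj_iff.2 ⟨h1, h2, forall_permDiagram
          (f := fun p => f (BrauerMap.place (-1) p))
          (he' (fun p => f (BrauerMap.place (-1) p)) h3 hk), h4⟩)
    have c4 := card_quot_circleAdj_le 𝔪.middle_mem σu σl hu hl hu' hl' 𝔪.β
    have s1 := card_le_card_strings 𝔪.upper_mem.1
    have s2 := card_le_card_strings 𝔪.middle_mem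
    have s3 := card_le_card_strings 𝔪.lower_mem.1
    have s4 : Nat.card I ≤ Nat.card (strings 𝔪.phi) :=
      card_le_card_strings (horizontalDiagram_mem 𝔪.α 𝔪.β)
    have n0 : Nat.card 𝔪.ZeroCell = 4 * Nat.card I := by
      rw [Nat.card_prod, Nat.card_zmod, mul_comm]
    have n1 : Nat.card 𝔪.OneCell = Nat.card (strings 𝔪.upper) + (Nat.card (strings 𝔪.middle) +
        (Nat.card (strings 𝔪.lower) + (Nat.card (strings 𝔪.phi) + Nat.card I))) := by
      simp only [Nat.card_sum]
    have n2 : Nat.card 𝔪.TwoCell = Nat.card 𝔪.CircleI + Nat.card 𝔪.CircleII := Nat.card_sum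
    have n3 : Nat.card I = 2 * Nat.card {v // arcSign a v = 1} := by
      have e1 : {v // arcSign a v = -1} ≃ {v // ¬arcSign a v = 1} :=
        Equiv.subtypeEquivRight fun v => (units_ne_one_iff _).symm
      classical
      rw [← Nat.card_congr (Equiv.sumCompl fun v => arcSign a v = 1), Nat.card_sum,
        ← Nat.card_congr e1, Nat.card_congr 𝔪.β, two_mul]
    have hh : 𝔪.h = horizontalCount 𝔪.upper + horizontalCount 𝔪.lower := rfl
    rw [BrauerMap.eulerChar, n0, n1, n2, hh]
    push_cast
    omega

end Reduction

/-! ### The relator of a surface group -/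

section Relator

variable {g : ℕ}

theorem wordValue_nil (g : ℕ) : wordValue g [] = 1 := map_one _

theorem wordValue_append (u v : List (Letter (SurfaceGen g))) :
    wordValue g (u ++ v) = wordValue g u * wordValue g v := by
  rw [wordValue, ← FreeGroup.mul_mk, map_mul]; rfl

theorem wordValue_cons (x : Letter (SurfaceGen g)) (v : List (Letter (SurfaceGen g))) :
    wordValue g (x :: v) = wordValue g [x] * wordValue g v :=
  wordValue_append [x] v

theorem wordValue_invRev (u : List (Letter (SurfaceGen g))) :
    wordValue g (FreeGroup.invRev u) = (wordValue g u)⁻¹ := by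
  rw [wordValue, ← FreeGroup.inv_mk, map_inv]; rfl

theorem wordValue_inv (x : Letter (SurfaceGen g)) :
    wordValue g [x.inv] = (wordValue g [x])⁻¹ :=
  wordValue_invRev [x]

theorem wordValue_surfaceWord (g : ℕ) : wordValue g (surfaceWord g) = 1 :=
  PresentedGroup.one_of_mem (Set.mem_singleton _)

/-- The letter following a given one in the cyclic word `[a_1 b_1] ⋯ [a_g b_g]`, in which every
letter occurs exactly once. -/
def nextLetter (g : ℕ) : Letter (SurfaceGen g) → Letter (SurfaceGen g)
  | (Sum.inl i, true) => (Sum.inr i, true)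
  | (Sum.inr i, true) => (Sum.inl i, false)
  | (Sum.inl i, false) => (Sum.inr i, false)
  | (Sum.inr i, false) => (Sum.inl (finRotate g i), true)

/-- The letter preceding a given one in the cyclic word `[a_1 b_1] ⋯ [a_g b_g]`. -/
def prevLetter (g : ℕ) : Letter (SurfaceGen g) → Letter (SurfaceGen g)
  | (Sum.inl i, true) => (Sum.inr ((finRotate g).symm i), false)
  | (Sum.inr i, true) => (Sum.inl i, true)
  | (Sum.inl i, false) => (Sum.inr i, true)
  | (Sum.inr i, false) => (Sum.inl i, false)

/-- The letter following a given one in the inverse of the cyclic word `[a_1 b_1] ⋯ [a_g b_g]`. -/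
def nextInvLetter (g : ℕ) (x : Letter (SurfaceGen g)) : Letter (SurfaceGen g) :=
  (prevLetter g x.inv).inv

theorem prevLetter_nextLetter (x : Letter (SurfaceGen g)) : prevLetter g (nextLetter g x) = x := by
  rcases x with ⟨i | i, _ | _⟩ <;>
    simp [nextLetter, prevLetter, -finRotate_apply, -finRotate_symm_apply]

theorem nextLetter_prevLetter (x : Letter (SurfaceGen g)) : nextLetter g (prevLetter g x) = x := by
  rcases x with ⟨i | i, _ | _⟩ <;>
    simp [nextLetter, prevLetter, -finRotate_apply, -finRotate_symm_apply]

theorem nextInvLetter_inv_nextLetter (x : Letter (SurfaceGen g)) :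
    nextInvLetter g (nextLetter g x).inv = x.inv := by
  rw [nextInvLetter, Letter.inv_inv, prevLetter_nextLetter]

theorem nextLetter_inv_nextInvLetter (x : Letter (SurfaceGen g)) :
    nextLetter g (nextInvLetter g x).inv = x.inv := by
  rw [nextInvLetter, Letter.inv_inv, nextLetter_prevLetter]

theorem nextLetter_ne_inv (x : Letter (SurfaceGen g)) : nextLetter g x ≠ x.inv := by
  rcases x with ⟨i | i, _ | _⟩ <;> simp [nextLetter, Letter.inv]

theorem nextLetter_inv_nextLetter_ne (x : Letter (SurfaceGen g)) :
    nextLetter g (nextLetter g x).inv ≠ x.inv := by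
  rcases x with ⟨i | i, _ | _⟩ <;> simp [nextLetter, Letter.inv]

theorem nextInvLetter_ne_inv (x : Letter (SurfaceGen g)) : nextInvLetter g x ≠ x.inv := by
  intro h
  have h1 := nextLetter_inv_nextInvLetter x
  rw [h, Letter.inv_inv] at h1
  exact nextLetter_ne_inv x h1

theorem nextInvLetter_inv_nextInvLetter_ne (x : Letter (SurfaceGen g)) :
    nextInvLetter g (nextInvLetter g x).inv ≠ x.inv := by
  intro h
  have h1 := nextLetter_inv_nextInvLetter x
  have h2 := nextLetter_inv_nextInvLetter (nextInvLetter g x).inv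
  rw [h, Letter.inv_inv, Letter.inv_inv] at h2
  exact nextLetter_inv_nextLetter_ne x (by rw [h2, h1])

/-- The index of a letter in the word `[a_1 b_1] ⋯ [a_g b_g]`. -/
def letterIndex (g : ℕ) : Letter (SurfaceGen g) → ℕ
  | (Sum.inl i, true) => 4 * i
  | (Sum.inr i, true) => 4 * i + 1
  | (Sum.inl i, false) => 4 * i + 2
  | (Sum.inr i, false) => 4 * i + 3

theorem letterIndex_lt (x : Letter (SurfaceGen g)) : letterIndex g x < 4 * g := by
  rcases x with ⟨i | i, _ | _⟩ <;> simp only [letterIndex] <;> have := i.2 <;> omega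

theorem letterIndex_injective : Function.Injective (letterIndex g) := by
  rintro ⟨i | i, _ | _⟩ ⟨j | j, _ | _⟩ h <;> simp only [letterIndex] at h <;>
    first
      | (exfalso; omega)
      | (have : i = j := Fin.ext (by omega)
         rw [this])

theorem letterIndex_nextLetter (x : Letter (SurfaceGen g)) :
    (letterIndex g (nextLetter g x) : ZMod (4 * g)) = letterIndex g x + 1 := by
  rcases x with ⟨i | i, _ | _⟩ <;> simp only [letterIndex, nextLetter]
  · push_cast; ring
  · push_cast; ring
  · obtain _ | g := g
    · exact i.elim0
    · rw [coe_finRotate]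
      split_ifs with h
      · subst h
        have : ((4 * (g + 1) : ℕ) : ZMod (4 * (g + 1))) = 0 := ZMod.natCast_self _
        rw [Fin.val_last]
        push_cast at this ⊢
        linear_combination -this
      · push_cast; ring
  · push_cast; ring

theorem letterIndex_iterate (x : Letter (SurfaceGen g)) (k : ℕ) :
    (letterIndex g ((nextLetter g)^[k] x) : ZMod (4 * g)) = letterIndex g x + k := by
  induction k with
  | zero => simp
  | succ k ih =>
    rw [Function.iterate_succ_apply', letterIndex_nextLetter, ih]
    push_cast; ring

theorem eq_of_letterIndex_cast {x y : Letter (SurfaceGen g)}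
    (h : (letterIndex g x : ZMod (4 * g)) = letterIndex g y) : x = y := by
  rw [ZMod.natCast_eq_natCast_iff'] at h
  rw [Nat.mod_eq_of_lt (letterIndex_lt x), Nat.mod_eq_of_lt (letterIndex_lt y)] at h
  exact letterIndex_injective h

theorem nextLetter_iterate_period (x : Letter (SurfaceGen g)) :
    (nextLetter g)^[4 * g] x = x :=
  eq_of_letterIndex_cast (by rw [letterIndex_iterate, ZMod.natCast_self, add_zero])

theorem le_of_nextLetter_iterate_eq {x : Letter (SurfaceGen g)} {k : ℕ} (hk : 0 < k)
    (h : (nextLetter g)^[k] x = x) : 4 * g ≤ k := by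
  have h1 := letterIndex_iterate x k
  rw [h, left_eq_add, ZMod.natCast_eq_zero_iff] at h1
  exact Nat.le_of_dvd hk h1

theorem surfaceWord_eq_iterate [NeZero g] :
    surfaceWord g = List.iterate (nextLetter g) (Sum.inl 0, true) (4 * g) := by
  have key : ∀ k ≤ g, ((List.finRange g).take k).flatMap (fun i =>
      [((Sum.inl i, true) : Letter (SurfaceGen g)), (Sum.inr i, true), (Sum.inl i, false),
        (Sum.inr i, false)]) = List.iterate (nextLetter g) (Sum.inl 0, true) (4 * k) := by
    intro k
    induction k with
    | zero => intro _; rfl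
    | succ k ih =>
      intro hk
      have hx : (nextLetter g)^[4 * k] (Sum.inl 0, true) = (Sum.inl ⟨k, hk⟩, true) := by
        refine eq_of_letterIndex_cast ?_
        rw [letterIndex_iterate]
        simp [letterIndex]
      rw [List.take_add_one, List.flatMap_append, ih (by omega), mul_add, mul_one,
        List.iterate_add, hx]
      rw [List.getElem?_eq_getElem (by simpa using hk)]
      simp [nextLetter, List.iterate]
  have := key g le_rfl
  rwa [List.take_of_length_le (by simp)] at this

theorem length_surfaceWord (g : ℕ) : (surfaceWord g).length = 4 * g := by
  obtain _ | g := g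
  · rfl
  · rw [surfaceWord_eq_iterate, List.length_iterate]

theorem val_finRotate {n : ℕ} (i : Fin n) : (finRotate n i).1 = (i.1 + 1) % n := by
  obtain _ | n := n
  · exact i.elim0
  · rw [coe_finRotate]
    split_ifs with h
    · rw [h, Fin.val_last, Nat.mod_self]
    · have := Fin.val_lt_last h
      rw [Nat.mod_eq_of_lt (by omega)]

theorem surfaceWord_get_finRotate (i : Fin (surfaceWord g).length) :
    (surfaceWord g).get (finRotate _ i) = nextLetter g ((surfaceWord g).get i) := by
  obtain _ | g := g
  · exact i.elim0
  · have hlen := length_surfaceWord (g + 1)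
    have hi := i.2
    have hget : ∀ j : Fin (surfaceWord (g + 1)).length,
        (surfaceWord (g + 1)).get j = (nextLetter (g + 1))^[j.1] (Sum.inl 0, true) := fun j => by
      rw [List.get_eq_getElem]
      simp only [surfaceWord_eq_iterate, List.getElem_iterate]
    rw [hget, hget, ← Function.iterate_succ_apply' (nextLetter (g + 1))]
    rw [val_finRotate]
    by_cases h : i.1 + 1 = (surfaceWord (g + 1)).length
    · rw [Nat.succ_eq_add_one, h, Nat.mod_self, hlen, nextLetter_iterate_period]
      rfl
    · rw [Nat.mod_eq_of_lt (by omega)]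

/-- A letter `N z` is assigned to every letter `z` in such a way that the letters
`z, N z, N² z, …` run around the boundary of a disc whose boundary word is a relator of length
`4g`, without repetition before the circuit is complete. -/
structure IsBoundaryStep (g : ℕ) (N : Letter (SurfaceGen g) → Letter (SurfaceGen g)) : Prop where
  value : ∀ z, wordValue g (List.iterate N z (4 * g)) = 1
  period : ∀ z k, 0 < k → N^[k] z = z → 4 * g ≤ k

theorem isBoundaryStep_nextLetter (g : ℕ) : IsBoundaryStep g (nextLetter g) := by
  refine ⟨fun z => ?_, fun z k hk h => le_of_nextLetter_iterate_eq hk h⟩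
  obtain _ | g := g
  · rfl
  · set x : Letter (SurfaceGen (g + 1)) := (Sum.inl 0, true)
    have hz : z = (nextLetter (g + 1))^[letterIndex _ z] x := by
      refine eq_of_letterIndex_cast ?_
      rw [letterIndex_iterate]
      simp [letterIndex, x]
    have h1 : wordValue (g + 1) (List.iterate (nextLetter (g + 1)) x (4 * (g + 1))) = 1 := by
      rw [← surfaceWord_eq_iterate, wordValue_surfaceWord]
    have h2 := List.iterate_add (nextLetter (g + 1)) x (letterIndex _ z) (4 * (g + 1))
    rw [add_comm (letterIndex _ z), List.iterate_add, nextLetter_iterate_period, ← hz] at h2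
    have h3 := congrArg (wordValue (g + 1)) h2
    rw [wordValue_append, wordValue_append, h1, one_mul] at h3
    exact left_eq_mul.1 h3

theorem isBoundaryStep_nextInvLetter (g : ℕ) : IsBoundaryStep g (nextInvLetter g) := by
  have hit : ∀ k y, (nextInvLetter g)^[k] ((nextLetter g)^[k] y).inv = y.inv := by
    intro k y
    induction k with
    | zero => rfl
    | succ k ih =>
      rw [Function.iterate_succ_apply, Function.iterate_succ_apply', nextInvLetter_inv_nextLetter,
        ih]
  have hsurj : ∀ k z, ∃ y, (nextLetter g)^[k] y = z := fun k z =>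
    (Function.Surjective.iterate (fun z => ⟨_, nextLetter_prevLetter z⟩) k) z
  have hval : ∀ k y, wordValue g (List.iterate (nextInvLetter g)
      (nextInvLetter g ((nextLetter g)^[k] y).inv) k) =
        (wordValue g (List.iterate (nextLetter g) y k))⁻¹ := by
    intro k y
    induction k with
    | zero => rw [List.iterate, List.iterate, wordValue_nil, inv_one]
    | succ k ih =>
      rw [Function.iterate_succ_apply', nextInvLetter_inv_nextLetter,
        List.iterate_add (nextLetter g), wordValue_append, mul_inv_rev, List.iterate,
        wordValue_cons, wordValue_inv, ih]
      rfl
  refine ⟨fun z => ?_, fun z k hk h => ?_⟩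
  · have h1 := hval (4 * g) (nextLetter g z.inv)
    rw [nextLetter_iterate_period, nextInvLetter_inv_nextLetter, Letter.inv_inv,
      (isBoundaryStep_nextLetter g).value, inv_one] at h1
    exact h1
  · obtain ⟨y, hy⟩ := hsurj k z.inv
    have h1 := hit k y
    rw [hy, Letter.inv_inv, h] at h1
    refine le_of_nextLetter_iterate_eq (x := y) hk ?_
    rw [hy, h1, Letter.inv_inv]

end Relator

/-! ### Strips of relator discs along a cyclically shortest word -/

section Strips

variable {g : ℕ}

/-- The subword of length `j` of a sequence of letters that starts at index `i`. -/
def subword {A : Type*} (x : ℕ → A) (i j : ℕ) : List A := (List.range j).map fun k => x (i + k)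

theorem length_subword {A : Type*} (x : ℕ → A) (i j : ℕ) : (subword x i j).length = j := by
  simp [subword]

theorem subword_succ {A : Type*} (x : ℕ → A) (i j : ℕ) :
    subword x i (j + 1) = subword x i j ++ [x (i + j)] := by
  simp [subword, List.range_succ]

theorem subword_one {A : Type*} (x : ℕ → A) (i : ℕ) : subword x i 1 = [x i] := rfl

theorem subword_add {A : Type*} (x : ℕ → A) (i j k : ℕ) :
    subword x i (j + k) = subword x i j ++ subword x (i + j) k := by
  induction k with
  | zero => simp [subword]
  | succ k ih => rw [← add_assoc, subword_succ, ih, subword_succ, List.append_assoc, add_assoc]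

/-- The corner between the letters of index `k` and `k + 1` of a word along which a row of relator
discs is glued: either both letters lie on the same disc, or on two discs that share the edge
following the first letter. The corner has charge `d k`, which is `2` or `-(4 g - 4)`
respectively. -/
def StripCorner (g : ℕ) (N : Letter (SurfaceGen g) → Letter (SurfaceGen g))
    (x : ℕ → Letter (SurfaceGen g)) (d : ℕ → ℤ) (k : ℕ) : Prop :=
  (x (k + 1) = N (x k) ∧ d k = 2) ∨ (x (k + 1) = N (N (x k)).inv ∧ d k = -(4 * g - 4))

variable {N : Letter (SurfaceGen g) → Letter (SurfaceGen g)} {x : ℕ → Letter (SurfaceGen g)}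
  {d : ℕ → ℤ} {L : ℕ}

theorem eq_iterate_of_run {i e : ℕ} (hx : ∀ k < e, x (i + k + 1) = N (x (i + k))) :
    ∀ k ≤ e, x (i + k) = N^[k] (x i) := by
  intro k
  induction k with
  | zero => intro _; rfl
  | succ k ih =>
    intro hk
    rw [← add_assoc, hx k (by omega), ih (by omega), Function.iterate_succ_apply']

/-- A shortest word contains no more than half of a relator. -/
theorem run_length_le (hN : IsBoundaryStep g N)
    (hgeo : ∀ i j, j ≤ L → ∀ v, wordValue g v = wordValue g (subword x i j) → j ≤ v.length)
    {i e : ℕ} (he : e < L) (hx : ∀ k < e, x (i + k + 1) = N (x (i + k))) (hg : 1 ≤ g) :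
    e + 1 ≤ 2 * g := by
  by_contra hc
  have h1 : subword x i (2 * g + 1) = List.iterate N (x i) (2 * g + 1) := by
    rw [← List.range_map_iterate, subword]
    refine List.map_congr_left fun k hk => ?_
    have := List.mem_range.1 hk
    exact eq_iterate_of_run hx k (by omega)
  have h2 := List.iterate_add N (x i) (2 * g + 1) (2 * g - 1)
  rw [show 2 * g + 1 + (2 * g - 1) = 4 * g by omega, ← h1] at h2
  have h3 := congrArg (wordValue g) h2
  rw [hN.value, wordValue_append] at h3
  have h4 := hgeo i (2 * g + 1) (by omega) _
    ((wordValue_invRev _).trans (eq_inv_of_mul_eq_one_left h3.symm).symm)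
  rw [FreeGroup.invRev_length, List.length_iterate] at h4
  omega

/-- Two consecutive edges `y⁻¹`, `N y⁻¹` of a relator disc, traversed the other way around. -/
theorem inv_mul_eq_complement (hN : IsBoundaryStep g N) (hg : 1 ≤ g) (y : Letter (SurfaceGen g)) :
    (wordValue g [y])⁻¹ * wordValue g [N y.inv] =
      (wordValue g (List.iterate N (N (N y.inv)) (4 * g - 2)))⁻¹ := by
  have h1 := hN.value y.inv
  rw [show 4 * g = 4 * g - 2 + 1 + 1 by omega, List.iterate, List.iterate, wordValue_cons,
    wordValue_cons (N y.inv), ← mul_assoc, wordValue_inv] at h1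
  exact eq_inv_of_mul_eq_one_left h1

/-- A row of relator discs glued along a subword of a shortest word provides another path with the
same end points, along the far side of the row. It is written as a word `u` followed by a part of
length `l` of the boundary of the last disc, and its length is governed by the charges of the
corners that were passed: passing to the next letter on the same disc shortens it by one, and
passing to a new disc lengthens it by `4 g - 3`. -/
theorem exists_far_side (hN : IsBoundaryStep g N)
    (hgeo : ∀ i j, j ≤ L → ∀ v, wordValue g v = wordValue g (subword x i j) → j ≤ v.length)
    (hg : 1 ≤ g) (b : ℕ) (V : SurfaceGroup g) {l₀ : ℕ} (hl₀ : 4 * g ≤ l₀ + 2)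
    (h₀ : V * wordValue g [x b] = (wordValue g (List.iterate N (N (x b)) l₀))⁻¹) :
    ∀ j, j + 1 ≤ L → (∀ k < j, StripCorner g N x d (b + k)) →
      ∃ u l s e, V * wordValue g (subword x b (j + 1)) =
          wordValue g u * (wordValue g (List.iterate N (N (x (b + j))) l))⁻¹ ∧
        (u.length + l : ℤ) = l₀ + j - ∑ k ∈ Finset.range j, d (b + k) ∧
        s + e = j ∧ (∀ k < e, x (b + s + k + 1) = N (x (b + s + k))) ∧ 4 * g ≤ l + e + 2 ∧
        1 ≤ l := by
  intro j
  induction j with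
  | zero =>
    intro _ _
    exact ⟨[], l₀, 0, 0, by rw [subword_one, h₀, wordValue_nil, one_mul]; rfl, by simp, rfl,
      by simp, by omega, by omega⟩
  | succ j ih =>
    intro hj hc
    obtain ⟨u, l, s, e, h1, h2, hse, h3, h4, h5⟩ := ih (by omega) fun k hk => hc k (by omega)
    obtain ⟨l, rfl⟩ : ∃ l', l = l' + 1 := ⟨l - 1, by omega⟩
    have hsum : ∑ k ∈ Finset.range (j + 1), d (b + k) =
      ∑ k ∈ Finset.range j, d (b + k) + d (b + j) := Finset.sum_range_succ _ _
    rw [List.iterate, wordValue_cons] at h1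
    push_cast at h2
    rcases hc j (by omega) with ⟨hx, hd⟩ | ⟨hx, hd⟩
    · have hrun : ∀ k < e + 1, x (b + s + k + 1) = N (x (b + s + k)) := fun k hk => by
        rcases Nat.lt_succ_iff_lt_or_eq.1 hk with hk | rfl
        · exact h3 k hk
        · rw [add_assoc b, hse, hx]
      have := run_length_le hN hgeo (by omega) hrun hg
      refine ⟨u, l, s, e + 1, ?_, ?_, by omega, hrun, by omega, by omega⟩
      · rw [subword_succ, wordValue_append, ← mul_assoc, h1, ← add_assoc b, hx, mul_inv_rev,
          mul_assoc, mul_assoc, inv_mul_cancel, mul_one]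
      · rw [hsum, hd]; push_cast; linarith
    · refine ⟨u ++ FreeGroup.invRev (List.iterate N (N (N (x (b + j)))) l), 4 * g - 2, j + 1, 0,
        ?_, ?_, by omega, by simp, by omega, by omega⟩
      · rw [subword_succ, wordValue_append, ← mul_assoc, h1, ← add_assoc b, hx, wordValue_append,
          wordValue_invRev, ← inv_mul_eq_complement hN hg]
        group
      · rw [hsum, hd, List.length_append, FreeGroup.invRev_length, List.length_iterate]
        push_cast [Nat.cast_sub (show 2 ≤ 4 * g by omega)]
        linarith

/-- The charge of a row of discs along a subword of a shortest word is bounded, since the far side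
of the row is not shorter than the subword. -/
theorem sum_strip_le (hN : IsBoundaryStep g N)
    (hgeo : ∀ i j, j ≤ L → ∀ v, wordValue g v = wordValue g (subword x i j) → j ≤ v.length)
    (hg : 1 ≤ g) (b j : ℕ) (hj : j + 1 ≤ L) (hc : ∀ k < j, StripCorner g N x d (b + k)) :
    ∑ k ∈ Finset.range j, d (b + k) ≤ 4 * g - 2 := by
  have h₀ : (1 : SurfaceGroup g) * wordValue g [x b] =
      (wordValue g (List.iterate N (N (x b)) (4 * g - 1)))⁻¹ := by
    have h1 := hN.value (x b)
    rw [show 4 * g = 4 * g - 1 + 1 by omega, List.iterate, wordValue_cons] at h1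
    rw [one_mul]
    exact eq_inv_of_mul_eq_one_left h1
  obtain ⟨u, l, -, -, h1, h2, -⟩ := exists_far_side hN hgeo hg b 1 (by omega) h₀ j hj hc
  rw [one_mul, ← wordValue_invRev, ← wordValue_append] at h1
  have h3 := hgeo b (j + 1) hj _ h1.symm
  rw [List.length_append, FreeGroup.invRev_length, List.length_iterate] at h3
  push_cast [Nat.cast_sub (show 1 ≤ 4 * g by omega)] at h2
  zify at h3
  linarith

/-- The charge of a closed row of discs along a cyclically shortest word is not positive, since the
word read along the far side of the resulting annulus is not shorter than the given one. -/
theorem sum_annulus_le (hN : IsBoundaryStep g N)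
    (hgeo : ∀ i j, j ≤ L → ∀ v, wordValue g v = wordValue g (subword x i j) → j ≤ v.length)
    (hcyc : ∀ v, IsConj (wordValue g (subword x 0 L)) (wordValue g v) → L ≤ v.length)
    (hg : 1 ≤ g) {j : ℕ} (hj : L = j + 1) (hper : x L = x 0)
    (hc : ∀ k < j, StripCorner g N x d k)
    (hlast : x (j + 1) = N (N (x j)).inv ∧ d j = -(4 * g - 4)) :
    ∑ k ∈ Finset.range L, d k ≤ 0 := by
  have hx0 : x 0 = N (N (x j)).inv := by rw [← hlast.1, ← hj, hper]
  have h₀ : (wordValue g [N (x j)])⁻¹ * wordValue g [x 0] =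
      (wordValue g (List.iterate N (N (x 0)) (4 * g - 2)))⁻¹ := by
    rw [hx0, inv_mul_eq_complement hN hg]
  obtain ⟨u, l, -, -, h1, h2, -, -, -, h5⟩ := exists_far_side hN hgeo hg 0 _ (by omega) h₀ j hj.ge
    (fun k hk => by rw [zero_add]; exact hc k hk)
  obtain ⟨l, rfl⟩ : ∃ l', l = l' + 1 := ⟨l - 1, by omega⟩
  simp only [zero_add] at h1 h2
  rw [List.iterate, wordValue_cons (N (x j)) (List.iterate N _ l), mul_inv_rev,
    ← wordValue_invRev (List.iterate _ _ _), ← mul_assoc, ← wordValue_append] at h1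
  have h3 := hcyc _ (isConj_iff.2 ⟨(wordValue g [N (x j)])⁻¹, by
    rw [hj, h1, inv_inv, mul_assoc, inv_mul_cancel, mul_one]⟩)
  rw [List.length_append, FreeGroup.invRev_length, List.length_iterate] at h3
  push_cast [Nat.cast_sub (show 2 ≤ 4 * g by omega)] at h2
  zify at h3
  rw [hj, Finset.sum_range_succ, hlast.2]
  rw [hj] at h3
  push_cast at h3
  linarith

/-- Whether a label belongs to the relator, that is, is `R` or `R⁻¹`. -/
def BdryLabel.isRel : BdryLabel → Bool
  | R => true
  | Rinv => true
  | W => false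
  | Winv => false

/-- The circuit around a relator disc that is followed by the letters of a word glued to it: a disc
with boundary word `r` is traversed against its orientation, hence along `r⁻¹`. -/
def gluedStep (g : ℕ) : BdryLabel → Letter (SurfaceGen g) → Letter (SurfaceGen g)
  | BdryLabel.Rinv => nextLetter g
  | _ => nextInvLetter g

theorem isBoundaryStep_gluedStep (g : ℕ) (l : BdryLabel) : IsBoundaryStep g (gluedStep g l) := by
  cases l <;> first | exact isBoundaryStep_nextLetter g | exact isBoundaryStep_nextInvLetter g

/-- The charge that an end of a row of discs costs at a corner, for the label `l` of the edge to
which the letter at this end is glued. -/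
def endCharge (g : ℕ) (l : BdryLabel) : ℤ := if l.isRel then 2 * g - 1 else 0

/-- The possibilities for the corner between the letters `x k` and `x (k + 1)` of a word, the
letters being glued to edges labelled `t k` and `t (k + 1)`: it is a corner of a row of
relator discs, or the rows of discs at the two letters end there. -/
def ChargedCorner (g : ℕ) (x : ℕ → Letter (SurfaceGen g)) (t : ℕ → BdryLabel) (d : ℕ → ℤ) (k : ℕ) :
    Prop :=
  ((t k).isRel = true ∧ t (k + 1) = t k ∧ StripCorner g (gluedStep g (t k)) x d k) ∨
    d k = -endCharge g (t k) - endCharge g (t (k + 1))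

theorem sum_range_periodic {d : ℕ → ℤ} (hd : ∀ k, d (k + L) = d k) (i : ℕ) :
    ∑ k ∈ Finset.range L, d (i + k) = ∑ k ∈ Finset.range L, d k := by
  induction i with
  | zero => simp
  | succ i ih =>
    rw [← ih]
    have h1 := Finset.sum_range_succ (fun k => d (i + k)) L
    have h2 := Finset.sum_range_succ' (fun k => d (i + k)) L
    rw [h1, hd, add_zero] at h2
    rw [add_left_injective _ h2]
    exact Finset.sum_congr rfl fun k _ => by rw [add_right_comm, add_assoc]

variable {t : ℕ → BdryLabel}

/-- The charges of a word that has a corner outside the rows of discs: the word is cut at this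
corner, and the rows of discs are treated one after the other. -/
theorem sum_charge_le_of_cut
    (hgeo : ∀ i j, j ≤ L → ∀ v, wordValue g v = wordValue g (subword x i j) → j ≤ v.length)
    (hg : 1 ≤ g) {j : ℕ} (hj : L = j + 1) (hper : t L = t 0)
    (hc : ∀ k, ChargedCorner g x t d k)
    (hlast : d j = -endCharge g (t j) - endCharge g (t (j + 1))) :
    ∑ k ∈ Finset.range L, d k ≤ 0 := by
  have hblock : ∀ s e, e + 1 ≤ L → (∀ k < e, (t s).isRel = true ∧
      StripCorner g (gluedStep g (t s)) x d (s + k)) →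
      ∑ k ∈ Finset.range e, d (s + k) ≤ 2 * endCharge g (t s) := by
    intro s e he hse
    by_cases hr : (t s).isRel = true
    · rw [endCharge, if_pos hr]
      have := sum_strip_le (isBoundaryStep_gluedStep g (t s)) hgeo hg s e he fun k hk =>
        (hse k hk).2
      linarith
    · obtain _ | e := e
      · simp [endCharge, hr]
      · exact absurd (hse 0 (by omega)).1 hr
  -- `s` is the first letter of the current row of discs.
  have key : ∀ i ≤ j, ∃ s e, s + e = i ∧ t i = t s ∧ (∀ k < e, (t s).isRel = true ∧
      StripCorner g (gluedStep g (t s)) x d (s + k)) ∧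
      ∑ k ∈ Finset.range i, d k - endCharge g (t 0) ≤
        ∑ k ∈ Finset.range e, d (s + k) - endCharge g (t s) := by
    intro i
    induction i with
    | zero => intro _; exact ⟨0, 0, rfl, rfl, by simp, by simp⟩
    | succ i ih =>
      intro hi
      obtain ⟨s, e, hse, hts, h1, h2⟩ := ih (by omega)
      rw [Finset.sum_range_succ]
      rcases hc i with ⟨hr, ht, hs⟩ | hd
      · refine ⟨s, e + 1, by omega, by rw [ht, hts], fun k hk => ?_, ?_⟩
        · rcases Nat.lt_succ_iff_lt_or_eq.1 hk with hk | rfl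
          · exact h1 k hk
          · rw [hse, ← hts]
            exact ⟨hr, hs⟩
        · rw [Finset.sum_range_succ, hse]
          linarith
      · refine ⟨i + 1, 0, rfl, rfl, by simp, ?_⟩
        have h3 := hblock s e (by omega) h1
        rw [hd, hts, Finset.sum_range_zero]
        linarith
  obtain ⟨s, e, hse, hts, h1, h2⟩ := key j le_rfl
  have h3 := hblock s e (by omega) h1
  rw [hj, Finset.sum_range_succ, hlast, ← hj, hper, hts]
  linarith

/-- The total charge of a cyclically shortest word is not positive. -/
theorem sum_charge_le (hg : 1 ≤ g) (hL : 0 < L) (hx : ∀ k, x (k + L) = x k)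
    (ht : ∀ k, t (k + L) = t k) (hd : ∀ k, d (k + L) = d k)
    (hcyc : ∀ i v, IsConj (wordValue g (subword x i L)) (wordValue g v) → L ≤ v.length)
    (hc : ∀ k, ChargedCorner g x t d k) :
    ∑ k ∈ Finset.range L, d k ≤ 0 := by
  have hgeo : ∀ i j, j ≤ L → ∀ v, wordValue g v = wordValue g (subword x i j) → j ≤ v.length := by
    intro i j hj v hv
    have h1 := hcyc i (v ++ subword x (i + j) (L - j)) (by
      rw [wordValue_append, hv, ← wordValue_append, ← subword_add, Nat.add_sub_cancel' hj])
    rw [List.length_append, length_subword] at h1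
    omega
  obtain ⟨j, hj⟩ : ∃ j, L = j + 1 := ⟨L - 1, by omega⟩
  have hshift : ∀ i k, i + 1 + j + k = i + k + L := fun i k => by omega
  by_cases hO : ∃ i, d i = -endCharge g (t i) - endCharge g (t (i + 1))
  · obtain ⟨i, hi⟩ := hO
    rw [← sum_range_periodic hd (i + 1)]
    refine sum_charge_le_of_cut (x := fun k => x (i + 1 + k)) (t := fun k => t (i + 1 + k))
      (d := fun k => d (i + 1 + k)) (fun i' j' hj' v hv => hgeo (i + 1 + i') j' hj' v ?_) hg hj
      (ht (i + 1)) (fun k => hc (i + 1 + k)) ?_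
    · rw [hv]
      simp only [subword, add_assoc]
    · show d (i + 1 + j) = -endCharge g (t (i + 1 + j)) - endCharge g (t (i + 1 + (j + 1)))
      rw [show i + 1 + j = i + L by omega, show i + 1 + (j + 1) = i + 1 + L by omega, hd,
        ht, ht, hi]
  · have hS : ∀ k, (t k).isRel = true ∧ t (k + 1) = t k ∧
        StripCorner g (gluedStep g (t k)) x d k := fun k =>
      (hc k).resolve_right fun h => hO ⟨k, h⟩
    have ht0 : ∀ k, t k = t 0 := fun k => by
      induction k with
      | zero => rfl
      | succ k ih => rw [(hS k).2.1, ih]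
    set N := gluedStep g (t 0)
    have hN : IsBoundaryStep g N := isBoundaryStep_gluedStep g _
    have hS' : ∀ k, StripCorner g N x d k := fun k => by
      have := (hS k).2.2
      rwa [ht0 k] at this
    by_cases hM : ∃ i, x (i + 1) = N (N (x i)).inv ∧ d i = -(4 * g - 4)
    · obtain ⟨i, hi, hi'⟩ := hM
      rw [← sum_range_periodic hd (i + 1)]
      refine sum_annulus_le (x := fun k => x (i + 1 + k)) (d := fun k => d (i + 1 + k)) hN
        (fun i' j' hj' v hv => hgeo (i + 1 + i') j' hj' v ?_)
        (fun v hv => hcyc (i + 1) v ?_) hg hj (hx (i + 1)) (fun k _ => hS' (i + 1 + k)) ⟨?_, ?_⟩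
      · rw [hv]
        simp only [subword, add_assoc]
      · simpa only [subword, zero_add] using hv
      · show x (i + 1 + (j + 1)) = N (N (x (i + 1 + j))).inv
        rw [show i + 1 + j = i + L by omega, show i + 1 + (j + 1) = i + 1 + L by omega, hx, hx, hi]
      · show d (i + 1 + j) = _
        rw [show i + 1 + j = i + L by omega, hd, hi']
    · -- The whole word runs around a single disc, hence contains a whole relator.
      have hD : ∀ k, x (k + 1) = N (x k) := fun k =>
        ((hS' k).resolve_right fun h => hM ⟨k, h⟩).1
      have h1 := eq_iterate_of_run (x := x) (N := N) (i := 0) (e := L)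
        (fun k _ => by simpa using hD k) L le_rfl
      have h2 := hN.period (x 0) L hL (by rw [← h1, hx])
      have h3 := run_length_le (i := 0) (e := 2 * g) hN hgeo (by omega)
        (fun k _ => by simpa using hD k) hg
      omega

end Strips

/-! ### Discharging -/

section Discharging

variable {g : ℕ} {I : Type}

/-- The circuit around a relator disc followed by its own boundary word. -/
def ownStep (g : ℕ) : BdryLabel → Letter (SurfaceGen g) → Letter (SurfaceGen g)
  | BdryLabel.R => nextLetter g
  | _ => nextInvLetter g

theorem ownStep_ne_inv (l : BdryLabel) (x : Letter (SurfaceGen g)) : ownStep g l x ≠ x.inv := by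
  cases l <;> first | exact nextLetter_ne_inv x | exact nextInvLetter_ne_inv x

theorem ownStep_inv_ownStep_ne (l : BdryLabel) (x : Letter (SurfaceGen g)) :
    ownStep g l (ownStep g l x).inv ≠ x.inv := by
  cases l <;>
    first | exact nextLetter_inv_nextLetter_ne x | exact nextInvLetter_inv_nextInvLetter_ne x

theorem gluedStep_inv_ownStep {l : BdryLabel} (hl : l.isRel = true) (x : Letter (SurfaceGen g)) :
    gluedStep g l (ownStep g l x).inv = x.inv := by
  cases l
  · exact nextInvLetter_inv_nextLetter x
  · exact nextLetter_inv_nextInvLetter x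
  · exact absurd hl (by decide)
  · exact absurd hl (by decide)

/-- The positions on the cycle of `v` under `T` carry the letters of a cyclically shortest word of
length `L`. -/
structure IsShortestCycle (g : ℕ) (T : Equiv.Perm I) (a : I → Letter (SurfaceGen g)) (v : I)
    (L : ℕ) : Prop where
  pos : 0 < L
  period : T^[L] v = v
  inj : Set.InjOn (fun k => T^[k] v) (Set.Iio L)
  shortest : ∀ i u, IsConj (wordValue g (subword (fun k => a (T^[k] v)) i L)) (wordValue g u) →
    L ≤ u.length

theorem IsShortestCycle.ne_inv {T : Equiv.Perm I} {a : I → Letter (SurfaceGen g)} {v : I} {L : ℕ}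
    (h : IsShortestCycle g T a v L) : a (T v) ≠ (a v).inv := by
  intro ha
  have hL := h.pos
  obtain rfl | ⟨j, rfl⟩ : L = 1 ∨ ∃ j, L = 2 + j := by
    rcases Nat.lt_or_ge L 2 with h1 | h1
    · left; omega
    · exact Or.inr ⟨L - 2, by omega⟩
  · have h1 : T v = v := h.period
    rw [h1] at ha
    exact Letter.inv_ne _ ha.symm
  · have h1 := h.shortest 0 (subword (fun k => a (T^[k] v)) 2 j) (by
      rw [subword_add, wordValue_append]
      have : subword (fun k => a (T^[k] v)) 0 2 = [a v, (a v).inv] := by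
        rw [← ha]; rfl
      rw [this, wordValue_cons, wordValue_inv, mul_inv_cancel, one_mul])
    rw [length_subword] at h1
    omega

/-- Positions glued by a sign-reversing involution `ι` and arranged by `T` into relators, inverse
relators and cyclically shortest words. The permutation `ι ∘ T` describes the circuits around the
vertices of the surface obtained by the gluing. -/
structure IsReducedGluing (g : ℕ) (a : I → Letter (SurfaceGen g)) (b : I → BdryLabel)
    (T ι : Equiv.Perm I) : Prop where
  involutive : ∀ v, ι (ι v) = v
  letter : ∀ v, a (ι v) = (a v).inv
  unfolded : ∀ v, ¬(b v = BdryLabel.R ∧ b (ι v) = BdryLabel.Rinv)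
  label : ∀ v, b (T v) = b v
  relator : ∀ v, (b v).isRel = true → a (T v) = ownStep g (b v) (a v)
  word : ∀ v, (b v).isRel ≠ true → ∃ L, IsShortestCycle g T a v L ∧
    ∀ v', b v' = b v → ∃ k < L, T^[k] v = v'

namespace IsReducedGluing

variable {a : I → Letter (SurfaceGen g)} {b : I → BdryLabel} {T ι : Equiv.Perm I}

theorem label_partner (h : IsReducedGluing g a b T ι) {v : I} (hv : (b v).isRel = true)
    (hv' : (b (ι v)).isRel = true) : b (ι v) = b v := by
  have h1 := h.unfolded v
  have h2 := h.unfolded (ι v)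
  rw [h.involutive] at h2
  generalize b v = l at *
  generalize b (ι v) = l' at *
  cases l <;> cases l' <;> simp_all [BdryLabel.isRel]

theorem label_corner (h : IsReducedGluing g a b T ι) {v : I} (hv : (b v).isRel = true)
    (hv' : (b (ι (T v))).isRel = true) : b (ι (T v)) = b v := by
  rw [h.label_partner (by rw [h.label, hv]) hv', h.label]

theorem step_eq_partner (h : IsReducedGluing g a b T ι) {u v : I} (huv : ι (T u) = v) :
    T u = ι v := by
  rw [← huv, h.involutive]

/-- No vertex consists of a single corner: neither a relator nor a shortest word backtracks. -/
theorem corner_ne_self (h : IsReducedGluing g a b T ι) (v : I) : ι (T v) ≠ v := by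
  intro hv
  have h1 : a (T v) = (a v).inv := by rw [h.step_eq_partner hv, h.letter]
  by_cases hr : (b v).isRel = true
  · rw [h.relator v hr] at h1
    exact ownStep_ne_inv _ _ h1
  · obtain ⟨L, hL, -⟩ := h.word v hr
    exact hL.ne_inv h1

/-- A vertex with relator corners only has at least three of them: no word of length two is a
subword both of the relator and of its inverse. -/
theorem corner_corner_ne_self (h : IsReducedGluing g a b T ι) {v : I} (hv : (b v).isRel = true)
    (hv' : (b (ι (T v))).isRel = true) : ι (T (ι (T v))) ≠ v := by
  intro hvv
  have h1 : a (T (ι (T v))) = (a v).inv := by rw [h.step_eq_partner hvv, h.letter]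
  rw [h.relator _ hv', h.label_corner hv hv', h.letter, h.relator v hv] at h1
  exact ownStep_inv_ownStep_ne _ _ h1

/-- At a vertex where a letter `u` of a word meets just one relator corner, the next letter is glued
to the same relator disc. -/
theorem letter_of_bigon (h : IsReducedGluing g a b T ι) {u : I}
    (h1 : (b (ι (T u))).isRel = true) (h2 : ι (T (ι (T u))) = u) :
    b (ι (T u)) = b (ι u) ∧ a (T u) = gluedStep g (b (ι u)) (a u) := by
  have h3 := h.step_eq_partner h2
  have h4 : b (ι (T u)) = b (ι u) := by rw [← h3, h.label]
  refine ⟨h4, ?_⟩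
  have h5 := gluedStep_inv_ownStep h1 (a (ι (T u)))
  rw [← h.relator _ h1, h3, h.letter, h.letter, Letter.inv_inv, Letter.inv_inv, h4] at h5
  exact h5.symm

/-- At a vertex where a letter `u` of a word meets exactly two relator corners, the next letter is
glued to a relator disc that shares an edge with the disc at `u`. -/
theorem letter_of_triangle (h : IsReducedGluing g a b T ι) {u : I}
    (h1 : (b (ι (T u))).isRel = true) (h2 : (b (ι (T (ι (T u))))).isRel = true)
    (h3 : ι (T (ι (T (ι (T u))))) = u) :
    b (ι (T u)) = b (ι u) ∧
      a (T u) = gluedStep g (b (ι u)) (gluedStep g (b (ι u)) (a u)).inv := by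
  set v := ι (T u) with hv
  have h4 := h.step_eq_partner h3
  have h5 : b (ι (T v)) = b v := h.label_corner h1 h2
  have h6 : b v = b (ι u) := by rw [← h4, h.label, h5]
  refine ⟨h6, ?_⟩
  have h7 := gluedStep_inv_ownStep h2 (a (ι (T v)))
  rw [← h.relator _ h2, h4, h.letter, h.letter, Letter.inv_inv, Letter.inv_inv, h5, h6] at h7
  have h8 := gluedStep_inv_ownStep h1 (a v)
  rw [← h.relator _ h1, hv, h.letter, Letter.inv_inv, ← hv, h6] at h8
  rw [h7, h8]

end IsReducedGluing

open Classical in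
/-- The charge of the corners at which a row of relator discs along a word continues: such a corner
belongs to a vertex where the word meets one or two relator corners. -/
noncomputable def rowCharge (g : ℕ) (b : I → BdryLabel) (c : Equiv.Perm I) (u : I) : ℤ :=
  if (b u).isRel ≠ true ∧ (b (c u)).isRel = true ∧ c (c u) = u then 2
  else if (b u).isRel ≠ true ∧ (b (c u)).isRel = true ∧ (b (c (c u))).isRel = true ∧
    c (c (c u)) = u then -(4 * g - 4) else 0

open Classical in
/-- The indicator function of the remaining corners of words. -/
noncomputable def endIndicator (b : I → BdryLabel) (c : Equiv.Perm I) (u : I) : ℤ :=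
  if (b u).isRel ≠ true ∧ ¬((b (c u)).isRel = true ∧ c (c u) = u) ∧
    ¬((b (c u)).isRel = true ∧ (b (c (c u))).isRel = true ∧ c (c (c u)) = u) then 1 else 0

/-- The weight of a corner in units of `1 / (8 g)`: a relator has total weight `2 g - 1`, and each
letter of a word has weight `1 / 2`. -/
def cornerWeight (g : ℕ) (b : I → BdryLabel) (u : I) : ℤ :=
  if (b u).isRel then 4 * g - 2 else 4 * g

/-- The weight of a corner after discharging: the corners of words at which rows of discs continue
receive or give away their charges, and relator corners support adjacent ends of rows. -/
noncomputable def dischargedWeight (g : ℕ) (b : I → BdryLabel) (c : Equiv.Perm I) (u : I) : ℤ :=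
  cornerWeight g b u + rowCharge g b c u -
    endCharge g (b u) * (endIndicator b c (c u) + endIndicator b c (c.symm u))

variable {a : I → Letter (SurfaceGen g)} {b : I → BdryLabel} {T ι : Equiv.Perm I}

theorem endIndicator_of_isRel {c : Equiv.Perm I} {u : I} (h : (b u).isRel = true) :
    endIndicator b c u = 0 :=
  if_neg fun h' => h'.1 h

theorem endIndicator_nonneg_le (c : Equiv.Perm I) (u : I) :
    0 ≤ endIndicator b c u ∧ endIndicator b c u ≤ 1 := by
  unfold endIndicator
  split_ifs <;> simp

theorem dischargedWeight_of_isRel {c : Equiv.Perm I} {u : I} (h : (b u).isRel = true) :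
    dischargedWeight g b c u = 4 * g - 2 -
      (2 * g - 1) * (endIndicator b c (c u) + endIndicator b c (c.symm u)) := by
  rw [dischargedWeight, cornerWeight, if_pos h, endCharge, if_pos h, rowCharge,
    if_neg fun h' => h'.1 h, if_neg fun h' => h'.1 h, add_zero]

theorem dischargedWeight_of_not_isRel {c : Equiv.Perm I} {u : I} (h : (b u).isRel ≠ true) :
    dischargedWeight g b c u = 4 * g + rowCharge g b c u := by
  rw [dischargedWeight, cornerWeight, if_neg h, endCharge, if_neg h, zero_mul, sub_zero]

theorem dischargedWeight_nonneg (hg : 2 ≤ g) (c : Equiv.Perm I) (u : I) :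
    0 ≤ dischargedWeight g b c u := by
  have hg' : (2 : ℤ) ≤ g := by exact_mod_cast hg
  by_cases h : (b u).isRel = true
  · rw [dischargedWeight_of_isRel h]
    have h1 := (endIndicator_nonneg_le (b := b) c (c u)).2
    have h2 := (endIndicator_nonneg_le (b := b) c (c.symm u)).2
    nlinarith
  · rw [dischargedWeight_of_not_isRel h, rowCharge]
    split_ifs <;> linarith

/-- After discharging, every vertex has total weight at least `1`. -/
theorem le_sum_dischargedWeight [Fintype I] [DecidableEq I] (hg : 2 ≤ g)
    (h : IsReducedGluing g a b T ι)
    (s : Finset I) (hs : s.Nonempty) (hsc' : ∀ u, (T.trans ι) u ∈ s ↔ u ∈ s) :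
    8 * (g : ℤ) ≤ ∑ u ∈ s, dischargedWeight g b (T.trans ι) u := by
  have hg' : (2 : ℤ) ≤ g := by exact_mod_cast hg
  set c := T.trans ι with hc
  have hsc : ∀ u ∈ s, c u ∈ s := fun u => (hsc' u).2
  have hsub : ∀ t ⊆ s, 8 * (g : ℤ) ≤ ∑ u ∈ t, dischargedWeight g b c u →
      8 * (g : ℤ) ≤ ∑ u ∈ s, dischargedWeight g b c u := fun t ht h' =>
    h'.trans (Finset.sum_le_sum_of_subset_of_nonneg ht fun u _ _ => dischargedWeight_nonneg hg c u)
  have hc1 : ∀ u, c u ≠ u := h.corner_ne_self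
  have hne : ∀ u, c (c u) ≠ c u := fun u h' => hc1 u (c.injective h')
  have two : ∀ u v, u ∈ s → v ∈ s → u ≠ v → 8 * (g : ℤ) ≤ dischargedWeight g b c u +
      dischargedWeight g b c v → 8 * (g : ℤ) ≤ ∑ u ∈ s, dischargedWeight g b c u := by
    intro u v hu hv huv h'
    refine hsub {u, v} (by simp [Finset.insert_subset_iff, hu, hv]) ?_
    rwa [Finset.sum_pair huv]
  have three : ∀ u, u ∈ s → c (c u) ≠ u → 8 * (g : ℤ) ≤ dischargedWeight g b c u +
      (dischargedWeight g b c (c u) + dischargedWeight g b c (c (c u))) →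
      8 * (g : ℤ) ≤ ∑ u ∈ s, dischargedWeight g b c u := by
    intro u hu huv h'
    refine hsub {u, c u, c (c u)}
      (by simp [Finset.insert_subset_iff, hu, hsc _ hu, hsc _ (hsc _ hu)]) ?_
    rwa [Finset.sum_insert (by simp [(hc1 u).symm, huv.symm]), Finset.sum_pair (hne u).symm]
  -- A cycle with a word corner at which a row of discs continues has length two or three. In any
  -- other cycle two word corners, or a word corner and two relator corners, or three relator
  -- corners suffice.
  by_cases hW : ∃ u ∈ s, (b u).isRel ≠ true
  · by_cases hD : ∃ u ∈ s, (b u).isRel ≠ true ∧ (b (c u)).isRel = true ∧ c (c u) = u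
    · obtain ⟨u, hu, h1, h2, h3⟩ := hD
      have he : endIndicator b c u = 0 := if_neg fun h' => h'.2.1 ⟨h2, h3⟩
      refine two u (c u) hu (hsc _ hu) (hc1 u).symm ?_
      rw [dischargedWeight_of_not_isRel h1, rowCharge, if_pos ⟨h1, h2, h3⟩,
        dischargedWeight_of_isRel h2, h3, Equiv.symm_apply_apply, he]
      linarith
    by_cases hM : ∃ u ∈ s, (b u).isRel ≠ true ∧ (b (c u)).isRel = true ∧
        (b (c (c u))).isRel = true ∧ c (c (c u)) = u
    · obtain ⟨u, hu, h1, h2, h3, h4⟩ := hM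
      have he : endIndicator b c u = 0 := if_neg fun h' => h'.2.2 ⟨h2, h3, h4⟩
      have h5 : c (c u) ≠ u := fun h5 => h1 (by rwa [h5] at h3)
      refine three u hu h5 ?_
      rw [dischargedWeight_of_not_isRel h1, rowCharge, if_neg fun h' => h5 h'.2.2,
        if_pos ⟨h1, h2, h3, h4⟩, dischargedWeight_of_isRel h2, dischargedWeight_of_isRel h3,
        Equiv.symm_apply_apply, Equiv.symm_apply_apply, h4, he, endIndicator_of_isRel h3,
        endIndicator_of_isRel h2]
      linarith
    push Not at hD hM
    have h0 : ∀ u ∈ s, (b u).isRel ≠ true → dischargedWeight g b c u = 4 * g := fun u hu h1 => by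
      rw [dischargedWeight_of_not_isRel h1, rowCharge,
        if_neg fun h' => hD u hu h'.1 h'.2.1 h'.2.2,
        if_neg fun h' => hM u hu h'.1 h'.2.1 h'.2.2.1 h'.2.2.2, add_zero]
    obtain ⟨u, hu, hu'⟩ := hW
    by_cases hV : ∃ v ∈ s, v ≠ u ∧ (b v).isRel ≠ true
    · obtain ⟨v, hv, hvu, hv'⟩ := hV
      refine two u v hu hv hvu.symm ?_
      rw [h0 u hu hu', h0 v hv hv']
      linarith
    · push Not at hV
      have h1 := hV _ (hsc _ hu) (hc1 u)
      have h2 : c (c u) ≠ u := hD u hu hu' h1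
      have h3 := hV _ (hsc _ (hsc _ hu)) h2
      have h4 := hV _ (hsc _ (hsc _ (hsc _ hu))) (hM u hu hu' h1 h3)
      have h5 := (endIndicator_nonneg_le (b := b) c u).2
      refine three u hu h2 ?_
      rw [h0 u hu hu', dischargedWeight_of_isRel h1, dischargedWeight_of_isRel h3,
        Equiv.symm_apply_apply, Equiv.symm_apply_apply, endIndicator_of_isRel h3,
        endIndicator_of_isRel h4, endIndicator_of_isRel h1]
      nlinarith
  · push Not at hW
    obtain ⟨u, hu⟩ := hs
    have hr : ∀ v ∈ s, dischargedWeight g b c v = 4 * g - 2 := fun v hv => by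
      have hv' : c.symm v ∈ s := by
        rwa [← hsc', Equiv.apply_symm_apply]
      rw [dischargedWeight_of_isRel (hW v hv), endIndicator_of_isRel (hW _ (hsc v hv)),
        endIndicator_of_isRel (hW _ hv'), add_zero, mul_zero, sub_zero]
    refine three u hu (h.corner_corner_ne_self (hW u hu) (hW _ (hsc u hu))) ?_
    rw [hr _ hu, hr _ (hsc _ hu), hr _ (hsc _ (hsc _ hu))]
    linarith

/-- The charges along a word satisfy the hypotheses of `sum_charge_le`. -/
theorem sum_rowCharge_le [Fintype I] [DecidableEq I] [DecidableEq BdryLabel]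
    (hg : 2 ≤ g) (h : IsReducedGluing g a b T ι)
    {v : I} (hv : (b v).isRel ≠ true) :
    ∑ u with b u = b v, (rowCharge g b (T.trans ι) u - endIndicator b (T.trans ι) u *
      (endCharge g (b (ι u)) + endCharge g (b (ι (T u))))) ≤ 0 := by
  obtain ⟨L, hL, hall⟩ := h.word v hv
  set d : I → ℤ := fun u => rowCharge g b (T.trans ι) u - endIndicator b (T.trans ι) u *
      (endCharge g (b (ι u)) + endCharge g (b (ι (T u)))) with hd
  have hlab : ∀ k, b (T^[k] v) = b v := fun k => by
    induction k with
    | zero => rfl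
    | succ k ih => rw [Function.iterate_succ_apply', h.label, ih]
  have hper : ∀ k, T^[k + L] v = T^[k] v := fun k => by
    rw [Function.iterate_add_apply, hL.period]
  have hset : Finset.univ.filter (fun u => b u = b v) =
      (Finset.range L).image fun k => T^[k] v := by
    ext u
    simp only [Finset.mem_filter, Finset.mem_univ, true_and, Finset.mem_image, Finset.mem_range]
    constructor
    · exact hall u
    · rintro ⟨k, -, rfl⟩
      exact hlab k
  have hsum : ∑ u with b u = b v, d u = ∑ k ∈ Finset.range L, d (T^[k] v) := by
    rw [hset, Finset.sum_image fun i hi j hj hij => hL.inj (by simpa using hi) (by simpa using hj)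
      hij]
  rw [hsum]
  refine sum_charge_le (x := fun k => a (T^[k] v)) (t := fun k => b (ι (T^[k] v)))
    (by omega : 1 ≤ g) hL.pos (fun k => by rw [hper]) (fun k => by rw [hper])
    (fun k => by rw [hper]) hL.shortest fun k => ?_
  have hk : (b (T^[k] v)).isRel ≠ true := by rw [hlab]; exact hv
  have hs : T^[k + 1] v = T (T^[k] v) := Function.iterate_succ_apply' _ _ _
  unfold ChargedCorner StripCorner
  simp only [hs]
  generalize T^[k] v = u at hk
  by_cases hD : (b (ι (T u))).isRel = true ∧ ι (T (ι (T u))) = u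
  · left
    obtain ⟨h1, h2⟩ := h.letter_of_bigon hD.1 hD.2
    refine ⟨by rw [← h1, hD.1], h1, Or.inl ⟨h2, ?_⟩⟩
    rw [hd]
    simp only
    rw [rowCharge, if_pos ⟨hk, hD⟩, endIndicator, if_neg fun h' => h'.2.1 hD, zero_mul, sub_zero]
  by_cases hM : (b (ι (T u))).isRel = true ∧ (b (ι (T (ι (T u))))).isRel = true ∧
      ι (T (ι (T (ι (T u))))) = u
  · left
    obtain ⟨h1, h2⟩ := h.letter_of_triangle hM.1 hM.2.1 hM.2.2
    refine ⟨by rw [← h1, hM.1], h1, Or.inr ⟨h2, ?_⟩⟩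
    rw [hd]
    simp only
    rw [rowCharge, if_neg fun h' => hD h'.2, if_pos ⟨hk, hM⟩, endIndicator,
      if_neg fun h' => h'.2.2 hM, zero_mul, sub_zero]
  · right
    rw [hd]
    simp only
    rw [rowCharge, if_neg fun h' => hD h'.2, if_neg fun h' => hM h'.2, endIndicator,
      if_pos ⟨hk, hD, hM⟩]
    ring

theorem IsReducedGluing.sum_charge_nonpos [Fintype I] [DecidableEq I] [DecidableEq BdryLabel]
    (hg : 2 ≤ g) (h : IsReducedGluing g a b T ι) :
    ∑ u, (rowCharge g b (T.trans ι) u - endIndicator b (T.trans ι) u *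
      (endCharge g (b (ι u)) + endCharge g (b (ι (T u))))) ≤ 0 := by
  set d : I → ℤ := fun u => rowCharge g b (T.trans ι) u - endIndicator b (T.trans ι) u *
      (endCharge g (b (ι u)) + endCharge g (b (ι (T u)))) with hd
  have hrel : ∀ u, (b u).isRel = true → d u = 0 := fun u hu => by
    rw [hd]
    simp only
    rw [endIndicator_of_isRel hu, rowCharge, if_neg fun h' => h'.1 hu, if_neg fun h' => h'.1 hu,
      zero_mul, sub_zero]
  have hword : ∀ l : BdryLabel, l.isRel ≠ true → ∑ u with b u = l, d u ≤ 0 := fun l hl => by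
    by_cases hv : ∃ v, b v = l
    · obtain ⟨v, rfl⟩ := hv
      exact sum_rowCharge_le hg h hl
    · rw [Finset.filter_false_of_mem fun u _ hu => hv ⟨u, hu⟩, Finset.sum_empty]
  have hsplit : ∑ u, d u =
      ∑ u with b u = BdryLabel.W, d u + ∑ u with b u = BdryLabel.Winv, d u := by
    rw [Finset.sum_filter, Finset.sum_filter, ← Finset.sum_add_distrib]
    refine Finset.sum_congr rfl fun u _ => ?_
    rcases hbu : b u
    · simp [hrel u (by rw [hbu]; rfl)]
    · simp [hrel u (by rw [hbu]; rfl)]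
    · simp
    · simp
  rw [hsplit]
  linarith [hword BdryLabel.W (by decide), hword BdryLabel.Winv (by decide)]

/-- The number of vertices of a reduced gluing is at most the total weight of the corners. -/
theorem IsReducedGluing.card_cycles_le [Fintype I] (hg : 2 ≤ g) (h : IsReducedGluing g a b T ι) :
    8 * (g : ℤ) * Nat.card (Quot fun x y => y = ι (T x)) ≤ ∑ u, cornerWeight g b u := by
  classical
  set c := T.trans ι with hc
  have hg' : (2 : ℤ) ≤ g := by exact_mod_cast hg
  have := Fintype.ofFinite (Quot fun x y => y = ι (T x))
  let cls : I → Quot fun x y => y = ι (T x) := Quot.mk _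
  have hcls : ∀ u, cls (c u) = cls u := fun u =>
    (Quot.sound (r := fun x y => y = ι (T x)) rfl).symm
  have h1 : ∀ q, 8 * (g : ℤ) ≤ ∑ u with cls u = q, dischargedWeight g b c u := by
    rintro ⟨v⟩
    exact le_sum_dischargedWeight hg h _ ⟨v, by simp [cls]⟩ fun u => by
      simp only [Finset.mem_filter, Finset.mem_univ, true_and]
      rw [← hc, hcls]
  have h2 : 8 * (g : ℤ) * Nat.card (Quot fun x y => y = ι (T x)) ≤
      ∑ u, dischargedWeight g b c u := by
    rw [← Finset.sum_fiberwise (g := cls), Nat.card_eq_fintype_card, mul_comm, ← nsmul_eq_mul]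
    exact Finset.card_nsmul_le_sum _ _ _ fun q _ => h1 q
  have h3 := h.sum_charge_nonpos hg
  rw [← hc] at h3
  have hin : ∀ u, endCharge g (b (c.symm u)) = endCharge g (b (ι u)) := fun u => by
    have : T (c.symm u) = ι u := by
      rw [hc, Equiv.symm_trans_apply, Equiv.apply_symm_apply, Equiv.symm_apply_eq, h.involutive]
    rw [← this, h.label]
  -- The charges of the ends of rows are moved between a word corner and its two neighbours.
  have e1 : ∑ u, endCharge g (b u) * endIndicator b c (c u) =
      ∑ u, endCharge g (b (ι u)) * endIndicator b c u := by
    rw [← Equiv.sum_comp c.symm]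
    exact Finset.sum_congr rfl fun u _ => by rw [hin, Equiv.apply_symm_apply]
  have e2 : ∑ u, endCharge g (b u) * endIndicator b c (c.symm u) =
      ∑ u, endCharge g (b (ι (T u))) * endIndicator b c u := by
    rw [← Equiv.sum_comp c]
    exact Finset.sum_congr rfl fun u _ => by rw [Equiv.symm_apply_apply]; rfl
  have h4 : ∑ u, dischargedWeight g b c u = ∑ u, cornerWeight g b u +
      ∑ u, (rowCharge g b c u - endIndicator b c u *
        (endCharge g (b (ι u)) + endCharge g (b (ι (T u))))) := by
    simp only [dischargedWeight, mul_add, Finset.sum_sub_distrib, Finset.sum_add_distrib, e1, e2]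
    simp only [mul_comm (endIndicator _ _ _)]
    ring
  linarith

end Discharging

/-! ### The second moment diagram as a reduced gluing -/

section SecondMoment

variable {g : ℕ}

theorem IsCyclicallyShortest.invRev {w : List (Letter (SurfaceGen g))}
    (hw : IsCyclicallyShortest g w) : IsCyclicallyShortest g (FreeGroup.invRev w) := by
  intro w' h
  obtain ⟨c, hc⟩ := isConj_iff.1 h
  have h1 := hw (FreeGroup.invRev w') (isConj_iff.2 ⟨c, by
    rw [wordValue_invRev, ← hc, wordValue_invRev]; group⟩)
  rwa [FreeGroup.invRev_length] at h1 ⊢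

theorem isConj_wordValue_rotate (w : List (Letter (SurfaceGen g))) (n : ℕ) :
    IsConj (wordValue g w) (wordValue g (w.rotate n)) := by
  rw [List.rotate_eq_drop_append_take_mod]
  conv_lhs => rw [← List.take_append_drop (n % w.length) w]
  rw [wordValue_append, wordValue_append]
  exact isConj_iff.2 ⟨(wordValue g (w.take (n % w.length)))⁻¹, by group⟩

theorem val_finRotate_iterate {L : ℕ} (i : Fin L) (k : ℕ) :
    ((finRotate L)^[k] i).1 = (i.1 + k) % L := by
  induction k with
  | zero => exact (Nat.mod_eq_of_lt i.2).symm
  | succ k ih =>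
    rw [Function.iterate_succ_apply', val_finRotate, ih, Nat.mod_add_mod, add_assoc]

/-- Positions that `T` arranges cyclically and that carry the letters of a cyclically shortest
word. -/
theorem isShortestCycle_of_embedding {I : Type} {w : List (Letter (SurfaceGen g))}
    (hw : IsCyclicallyShortest g w) {T : Equiv.Perm I} {a : I → Letter (SurfaceGen g)}
    (f : Fin w.length → I) (hf : Function.Injective f) (hT : ∀ i, T (f i) = f (finRotate _ i))
    (ha : ∀ i, a (f i) = w.get i) (i : Fin w.length) :
    IsShortestCycle g T a (f i) w.length ∧ ∀ j, ∃ k < w.length, T^[k] (f i) = f j := by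
  have hL : 0 < w.length := i.pos
  have hit : ∀ k, T^[k] (f i) = f ((finRotate _)^[k] i) := fun k => by
    induction k with
    | zero => rfl
    | succ k ih => rw [Function.iterate_succ_apply', ih, hT, Function.iterate_succ_apply']
  refine ⟨⟨hL, ?_, ?_, ?_⟩, fun j => ?_⟩
  · rw [hit]
    congr 1
    apply Fin.ext
    rw [val_finRotate_iterate, Nat.add_mod_right, Nat.mod_eq_of_lt i.2]
  · intro k hk l hl hkl
    simp only [hit] at hkl
    have h1 := congrArg Fin.val (hf hkl)
    rw [val_finRotate_iterate, val_finRotate_iterate] at h1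
    have h2 : k ≡ l [MOD w.length] := Nat.ModEq.add_left_cancel' i.1 h1
    exact Nat.ModEq.eq_of_lt_of_lt h2 hk hl
  · intro n u hu
    have h1 : subword (fun k => a (T^[k] (f i))) n w.length = w.rotate (i.1 + n) := by
      refine List.ext_getElem (by rw [length_subword, List.length_rotate]) fun k hk hk' => ?_
      simp only [subword, List.getElem_map, List.getElem_range, List.getElem_rotate, hit, ha,
        List.get_eq_getElem, val_finRotate_iterate]
      congr 2
      omega
    rw [h1] at hu
    exact hw u ((isConj_wordValue_rotate w _).trans hu)
  · refine ⟨(j.1 + (w.length - i.1)) % w.length, Nat.mod_lt _ hL, ?_⟩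
    rw [hit]
    congr 1
    apply Fin.ext
    rw [val_finRotate_iterate, Nat.add_mod_mod,
      show i.1 + (j.1 + (w.length - i.1)) = j.1 + w.length by omega, Nat.add_mod_right,
      Nat.mod_eq_of_lt j.2]

theorem wordDiagram_neg_sign {X : Type} (w : List (Letter X)) (i : Fin w.length) :
    (wordDiagram w (i, -(w.get i).sign)).1 = finRotate _ i := by
  simp only [wordDiagram, transposeDiagram, mul_neg, Int.units_mul_self]
  rfl

theorem wordDiagram_sign {X : Type} (w : List (Letter X)) (i : Fin w.length) :
    (wordDiagram w (i, (w.get i).sign)).1 = (finRotate _).symm i := by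
  simp only [wordDiagram, transposeDiagram, Int.units_mul_self]
  rfl

theorem walledStep_relator {X : Type} {n m : ℕ} {r w : List (Letter X)}
    {π : Diagram (SecondMomentIndex n m r w)}
    (hm : π ∈ walledDiagrams (arcSign (secondMomentArc n m r w)))
    (hπ : π = secondMomentDiagram n m r w)
    (i : Fin r.length) (k : Fin n) :
    walledStep hm (Sum.inl (i, Sum.inl k)) = Sum.inl (finRotate _ i, Sum.inl k) := by
  subst hπ
  show Sum.inl ((wordDiagram r (i, -(r.get i).sign)).1, Sum.inl k) = _
  rw [wordDiagram_neg_sign]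

theorem walledStep_relator_inv {X : Type} {n m : ℕ} {r w : List (Letter X)}
    {π : Diagram (SecondMomentIndex n m r w)}
    (hm : π ∈ walledDiagrams (arcSign (secondMomentArc n m r w)))
    (hπ : π = secondMomentDiagram n m r w)
    (i : Fin r.length) (k : Fin m) :
    walledStep hm (Sum.inl (i, Sum.inr k)) = Sum.inl ((finRotate _).symm i, Sum.inr k) := by
  subst hπ
  show Sum.inl ((wordDiagram r (i, -(r.get i).inv.sign)).1, Sum.inr k) = _
  rw [Letter.sign_inv, neg_neg, wordDiagram_sign]

theorem walledStep_word {X : Type} {n m : ℕ} {r w : List (Letter X)}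
    {π : Diagram (SecondMomentIndex n m r w)}
    (hm : π ∈ walledDiagrams (arcSign (secondMomentArc n m r w)))
    (hπ : π = secondMomentDiagram n m r w)
    (i : Fin w.length) :
    walledStep hm (Sum.inr (Sum.inl i)) = Sum.inr (Sum.inl (finRotate _ i)) := by
  subst hπ
  show Sum.inr (Sum.inl (wordDiagram w (i, -(w.get i).sign)).1) = _
  rw [wordDiagram_neg_sign]

theorem walledStep_word_inv {X : Type} {n m : ℕ} {r w : List (Letter X)}
    {π : Diagram (SecondMomentIndex n m r w)}
    (hm : π ∈ walledDiagrams (arcSign (secondMomentArc n m r w)))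
    (hπ : π = secondMomentDiagram n m r w)
    (i : Fin (FreeGroup.invRev w).length) :
    walledStep hm (Sum.inr (Sum.inr i)) = Sum.inr (Sum.inr (finRotate _ i)) := by
  subst hπ
  show Sum.inr (Sum.inr (wordDiagram (FreeGroup.invRev w)
    (i, -Letter.sign ((FreeGroup.invRev w).get i))).1) = _
  rw [wordDiagram_neg_sign]

theorem letter_partner_of_mem {I X : Type} {a : I → Letter X} {b : I → BdryLabel}
    {β : SignMatching (arcSign a)} (hβ : β ∈ admissibleMatchings a b) (v : I) :
    a (β.partner v) = (a v).inv := by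
  rcases Int.units_eq_one_or (arcSign a v) with h | h
  · have h1 := hβ.1 (β.symm ⟨v, h⟩)
    rw [Equiv.apply_symm_apply] at h1
    rw [partner_of_pos β h, ← Letter.inv_inv (a _), ← h1]
  · rw [partner_of_neg β h]
    exact hβ.1 ⟨v, h⟩

theorem label_partner_of_mem {I X : Type} {a : I → Letter X} {b : I → BdryLabel}
    {β : SignMatching (arcSign a)} (hβ : β ∈ admissibleMatchings a b) (v : I) :
    ¬(b v = BdryLabel.R ∧ b (β.partner v) = BdryLabel.Rinv) := by
  rcases Int.units_eq_one_or (arcSign a v) with h | h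
  · have h1 := (hβ.2 (β.symm ⟨v, h⟩)).2
    rw [Equiv.apply_symm_apply] at h1
    rw [partner_of_pos β h]
    exact fun h2 => h1 ⟨h2.2, h2.1⟩
  · rw [partner_of_neg β h]
    exact (hβ.2 ⟨v, h⟩).1

/-- The second moment diagram, completed by colour-preserving permutations and an admissible
matching, is a reduced gluing. -/
theorem isReducedGluing_secondMoment {w : List (Letter (SurfaceGen g))}
    (hw : IsCyclicallyShortest g w) {n m : ℕ}
    {a : SecondMomentIndex n m (surfaceWord g) w → Letter (SurfaceGen g)}
    {b : SecondMomentIndex n m (surfaceWord g) w → BdryLabel}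
    (ha : a = secondMomentArc n m (surfaceWord g) w)
    (hb : b = secondMomentBdry n m (surfaceWord g) w)
    {π : Diagram (SecondMomentIndex n m (surfaceWord g) w)}
    (hm : π ∈ walledDiagrams (arcSign a)) (hπ : π = secondMomentDiagram n m (surfaceWord g) w)
    {β : SignMatching (arcSign a)} (hβ : β ∈ admissibleMatchings a b)
    {ρ ρ' : Equiv.Perm (SecondMomentIndex n m (surfaceWord g) w)}
    (hρ : ∀ v, a (ρ v) = a v ∧ b (ρ v) = b v) (hρ' : ∀ v, a (ρ' v) = a v ∧ b (ρ' v) = b v)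
    (hfix : ∀ v, b v = BdryLabel.W ∨ b v = BdryLabel.Winv → ρ v = v ∧ ρ' v = v) :
    IsReducedGluing g a b ((ρ'.trans (walledStep hm)).trans ρ) (partnerPerm β) := by
  set T := (ρ'.trans (walledStep hm)).trans ρ
  have hT : ∀ v, T v = ρ (walledStep hm (ρ' v)) := fun v => rfl
  have hstep : ∀ v, b (walledStep hm v) = b v := by
    subst ha hb
    rintro (⟨i, k | k⟩ | i | i)
    · rw [walledStep_relator hm hπ]; rfl
    · rw [walledStep_relator_inv hm hπ]; rfl
    · rw [walledStep_word hm hπ]; rfl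
    · rw [walledStep_word_inv hm hπ]; rfl
  have hown : ∀ v, (b v).isRel = true → a (walledStep hm v) = ownStep g (b v) (a v) := by
    subst ha hb
    rintro (⟨i, k | k⟩ | i | i) hv
    · rw [walledStep_relator hm hπ]
      exact surfaceWord_get_finRotate i
    · rw [walledStep_relator_inv hm hπ]
      have h1 := surfaceWord_get_finRotate ((finRotate _).symm i)
      rw [Equiv.apply_symm_apply] at h1
      show ((surfaceWord g).get _).inv = nextInvLetter g ((surfaceWord g).get i).inv
      rw [h1, nextInvLetter_inv_nextLetter]
    · exact absurd hv Bool.false_ne_true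
    · exact absurd hv Bool.false_ne_true
  refine ⟨partner_partner β, letter_partner_of_mem hβ, label_partner_of_mem hβ, fun v => ?_,
    fun v hv => ?_, ?_⟩
  · rw [hT, (hρ _).2, hstep, (hρ' _).2]
  · rw [hT, (hρ _).1, hown _ (by rw [(hρ' _).2, hv]), (hρ' _).1, (hρ' _).2]
  · subst ha hb
    rintro (⟨i, k | k⟩ | i | i) hv
    · exact absurd rfl hv
    · exact absurd rfl hv
    · obtain ⟨h1, h2⟩ := isShortestCycle_of_embedding hw (T := T)
        (a := secondMomentArc n m (surfaceWord g) w)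
        (fun i => Sum.inr (Sum.inl i)) (fun i j h => by simpa using h)
        (fun j => by
          rw [hT, (hfix _ (Or.inl rfl)).2, walledStep_word hm hπ, (hfix _ (Or.inl rfl)).1])
        (fun _ => rfl) i
      refine ⟨_, h1, ?_⟩
      rintro (⟨j, k | k⟩ | j | j) hj
      · exact absurd hj (by simp [secondMomentBdry, extendBdry])
      · exact absurd hj (by simp [secondMomentBdry, extendBdry, BdryLabel.inv])
      · exact h2 j
      · exact absurd hj (by simp [secondMomentBdry])
    · obtain ⟨h1, h2⟩ := isShortestCycle_of_embedding hw.invRev (T := T)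
        (a := secondMomentArc n m (surfaceWord g) w)
        (fun i => Sum.inr (Sum.inr i)) (fun i j h => by simpa using h)
        (fun j => by
          rw [hT, (hfix _ (Or.inr rfl)).2, walledStep_word_inv hm hπ, (hfix _ (Or.inr rfl)).1])
        (fun _ => rfl) i
      refine ⟨_, h1, ?_⟩
      rintro (⟨j, k | k⟩ | j | j) hj
      · exact absurd hj (by simp [secondMomentBdry, extendBdry])
      · exact absurd hj (by simp [secondMomentBdry, extendBdry, BdryLabel.inv])
      · exact absurd hj (by simp [secondMomentBdry])
      · exact h2 j

theorem sum_cornerWeight_secondMoment (w : List (Letter (SurfaceGen g))) (n m : ℕ) :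
    ∑ u, cornerWeight g (secondMomentBdry n m (surfaceWord g) w) u =
      8 * (g : ℤ) * ((2 * g - 1) * (n + m) + w.length) := by
  have h1 : ∀ u, cornerWeight g (secondMomentBdry n m (surfaceWord g) w) (Sum.inl u) =
      4 * g - 2 := by
    rintro ⟨i, k | k⟩ <;> rfl
  have h2 : ∀ u, cornerWeight g (secondMomentBdry n m (surfaceWord g) w) (Sum.inr u) =
      4 * g := by
    rintro (i | i) <;> rfl
  simp only [Fintype.sum_sum_type (α₁ := Fin _ × _), h1, h2, Finset.sum_const, Finset.card_univ,
    Fintype.card_prod, Fintype.card_sum, Fintype.card_fin, FreeGroup.invRev_length,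
    length_surfaceWord, nsmul_eq_mul]
  push_cast
  ring

theorem card_secondMomentIndex (w : List (Letter (SurfaceGen g))) (n m : ℕ) :
    Nat.card (SecondMomentIndex n m (surfaceWord g) w) = 4 * g * (n + m) + 2 * w.length := by
  simp only [Nat.card_eq_fintype_card, Fintype.card_prod, Fintype.card_sum, Fintype.card_fin,
    FreeGroup.invRev_length, length_surfaceWord]
  ring

end SecondMoment

end WalledBrauer

open WalledBrauer
theorem mainTheorem6 (g : ℕ) (hg : 2 ≤ g) (w : List (Letter (SurfaceGen g)))
    (hw : IsCyclicallyShortest g w) (n m : ℕ)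
    (𝔪 : BrauerMap (secondMomentArc n m (surfaceWord g) w)
      (secondMomentBdry n m (surfaceWord g) w))
    (hπ : 𝔪.middle = secondMomentDiagram n m (surfaceWord g) w)
    (h𝔪 : 𝔪.IsAdmissible) :
    𝔪.eulerChar ≤ -(n : ℤ) - (m : ℤ) + (𝔪.h : ℤ) := by
  obtain ⟨-, hβ, hid⟩ := h𝔪
  obtain ⟨ρ, ρ', hρ, hρ', hfix, hχ⟩ := eulerChar_le_of_cycles 𝔪
  have h1 := (isReducedGluing_secondMoment hw rfl rfl 𝔪.middle_mem hπ hβ hρ hρ' fun v hv =>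
    hfix v (hid v hv)).card_cycles_le hg
  rw [sum_cornerWeight_secondMoment] at h1
  have h2 := le_of_mul_le_mul_left h1 (by positivity)
  rw [card_secondMomentIndex] at hχ
  push_cast at hχ
  have h3 : (Nat.card (Quot fun x y => y = partnerPerm 𝔪.β
      (((ρ'.trans (walledStep 𝔪.middle_mem)).trans ρ) x)) : ℤ) = Nat.card (Quot fun x y =>
      y = 𝔪.β.partner (ρ (walledStep 𝔪.middle_mem (ρ' x)))) := rfl
  rw [h3] at h2
  linarith
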